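/- Let $n\ge 1$ and let $I=\{1,\dots,n,\overline n,\dots,\overline 1\}$ be ordered by $1\prec 2\prec\dots\prec n\prec\overline n\prec\dots\prec\overline 2\prec\overline 1$. Let $\mathcal Z$ be the commutative ring generated by symbols $z_{i,a}$ ($i\in I$, $a\in\mathbb C$) subject to the relations $$z_{i,a}\,z_{\overline i,a-2n+2i-4}=z_{i-1,a}\,z_{\overline{i-1},a-2n+2i-4}\qquad(1\le i\le n,\ a\in\mathbb C),$$ where $z_{0,a}=z_{\overline 0,a}=1$. Let $\mathcal A$ be the non-commutative ring of formal power series $\sum_{k\ge 0} r_kX^k$ ($r_k\in\mathcal Z$) with multiplication determined by $X z_{i,a}=z_{i,a-2}X$. For $a\in\mathbb C$ define $h_{m,a}\in\mathcal Z$ by $$\sum_{m\ge 0}h_{m,a}X^m=(1-z_{\overline 1,a}X)^{-1}\cdots(1-z_{\overline n,a}X)^{-1}\,(1-z_{n,a}Xz_{\overline n,a}X)^{-1}\,(1-z_{n,a}X)^{-1}\cdots(1-z_{1,a}X)^{-1},$$ and $h_{m,a}=0$ for $m<0$. For partitions $\mu\subset\lambda$ with $l=l(\lambda)$ the number of non-zero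 parts of $\lambda$, put $$\chi_{\lambda/\mu,a}=\det\bigl(h_{\lambda_i-\mu_j-i+j,\;a+2(\lambda_i-i)}\bigr)_{1\le i,j\le l}.$$ A tableau $T$ of shape $\lambda/\mu=\{(i,j):\mu_i<j\le\lambda_i\}$ ($i$ the row, $j$ the column) is a map $T:\lambda/\mu\to I$, and $z^T_a=\prod_{(i,j)\in\lambda/\mu}z_{T(i,j),\,a+2(j-i)}$. Call $T$ an HV-tableau if the following two rules hold. (H) Whenever $(i,j),(i,j+1)\in\lambda/\mu$, one has $T(i,j)\preceq T(i,j+1)$ or $(T(i,j),T(i,j+1))=(\overline n,n)$; and no three consecutive entries $T(i,j-1),T(i,j),T(i,j+1)$ of a row are $(\overline n,\overline n,n)$ or $(\overline n,n,n)$. (V) Whenever $(i,j),(i+1,j)\in\lambda/\mu$, at least one of the following holds: $T(i,j)\prec T(i+1,j)$; or $T(i,j)=T(i+1,j)=n$, $(i+1,j-1)\in\lambda/\mu$ and $T(i+1,j-1)=\overline n$; or $T(i,j)=T(i+1,j)=\overline n$, $(i,j+1)\in\lambda/\mu$ and $T(i,j+1)=n$. Say that $T$ satisfies (E-2R) if,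 whenever $k$ is odd and the consecutive columns $j,j+1,\dots,j+k-1$ all satisfy $T(i,\cdot)=n$ and $T(i+1,\cdot)=\overline n$ (all these boxes lying in $\lambda/\mu$), at least one of the following holds: $(i,j+k)\in\lambda/\mu$ and $T(i,j+k)=n$; or $(i+1,j-1)\in\lambda/\mu$ and $T(i+1,j-1)=\overline n$. **Theorem.** For every pair of partitions $\mu\subset\lambda$ with $l(\lambda)=2$ and every $a\in\mathbb C$, $$\chi_{\lambda/\mu,a}=\sum_T z^T_a\qquad\text{in }\mathcal Z,$$ where $T$ runs over all HV-tableaux of shape $\lambda/\mu$ that satisfy (E-2R). -/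

import Mathlib

/-! Skew formal power series `R⟦X; σ⟧`, with the rule `X * r = σ r * X` and coefficients
written on the left. -/

/-- Formal series `∑ r_k X^k` over `R`, multiplied according to `X * r = σ r * X`. -/
def SkewPowerSeries {R : Type*} [CommRing R] (_σ : R →+* R) : Type _ := ℕ → R

namespace SkewPowerSeries

variable {R : Type*} [CommRing R] {σ : R →+* R}

/-- The coefficient of `X^k` (coefficients stand to the left of the powers of `X`). -/
def coeff (k : ℕ) (f : SkewPowerSeries σ) : R := f k

/-- The series with coefficients `c 0, c 1, …`. -/
def mk (c : ℕ → R) : SkewPowerSeries σ := c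

theorem coeff_mk (k : ℕ) (c : ℕ → R) : coeff k (mk c : SkewPowerSeries σ) = c k := rfl

@[ext] theorem ext {f g : SkewPowerSeries σ} (h : ∀ k, coeff k f = coeff k g) : f = g :=
  funext h

instance : AddCommGroup (SkewPowerSeries σ) := inferInstanceAs (AddCommGroup (ℕ → R))

/-- The constant series `r`. -/
def C (r : R) : SkewPowerSeries σ := mk fun k => if k = 0 then r else 0

/-- The variable `X`. -/
def X : SkewPowerSeries σ := mk fun k => if k = 1 then 1 else 0

instance : One (SkewPowerSeries σ) := ⟨C 1⟩

/-- `(∑ r_i X^i) * (∑ s_j X^j) = ∑_{i,j} r_i σ^i(s_j) X^(i+j)`. -/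
instance : Mul (SkewPowerSeries σ) :=
  ⟨fun f g => mk fun k => ∑ p ∈ Finset.HasAntidiagonal.antidiagonal k, coeff p.1 f * (σ ^ p.1) (coeff p.2 g)⟩

theorem coeff_add (k : ℕ) (f g : SkewPowerSeries σ) :
    coeff k (f + g) = coeff k f + coeff k g := rfl

theorem coeff_zero (k : ℕ) : coeff k (0 : SkewPowerSeries σ) = 0 := rfl

theorem coeff_one (k : ℕ) : coeff k (1 : SkewPowerSeries σ) = if k = 0 then 1 else 0 := rfl

theorem coeff_C (k : ℕ) (r : R) : coeff k (C r : SkewPowerSeries σ) = if k = 0 then r else 0 :=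
  rfl

theorem coeff_X (k : ℕ) : coeff k (X : SkewPowerSeries σ) = if k = 1 then 1 else 0 := rfl

theorem coeff_mul (k : ℕ) (f g : SkewPowerSeries σ) :
    coeff k (f * g) =
      ∑ p ∈ Finset.HasAntidiagonal.antidiagonal k, coeff p.1 f * (σ ^ p.1) (coeff p.2 g) := rfl

protected theorem mul_assoc (f g h : SkewPowerSeries σ) : f * g * h = f * (g * h) := by
  ext k
  simp only [coeff_mul, map_sum, map_mul, Finset.sum_mul, Finset.mul_sum, Finset.sum_sigma']
  refine Finset.sum_nbij' (fun ⟨⟨_i, j⟩, ⟨k, l⟩⟩ => ⟨(k, l + j), (l, j)⟩)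
    (fun ⟨⟨i, _j⟩, ⟨k, l⟩⟩ => ⟨(i + k, l), (i, k)⟩) ?_ ?_ ?_ ?_ ?_
  · rintro ⟨⟨i, j⟩, ⟨k, l⟩⟩ hp
    simp only [Finset.mem_sigma, Finset.HasAntidiagonal.mem_antidiagonal] at hp ⊢
    obtain ⟨rfl, rfl⟩ := hp
    exact ⟨by ring, trivial⟩
  · rintro ⟨⟨i, j⟩, ⟨k, l⟩⟩ hp
    simp only [Finset.mem_sigma, Finset.HasAntidiagonal.mem_antidiagonal] at hp ⊢
    obtain ⟨rfl, rfl⟩ := hp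
    exact ⟨by ring, trivial⟩
  · rintro ⟨⟨i, j⟩, ⟨k, l⟩⟩ hp
    simp only [Finset.mem_sigma, Finset.HasAntidiagonal.mem_antidiagonal] at hp
    obtain ⟨rfl, rfl⟩ := hp
    rfl
  · rintro ⟨⟨i, j⟩, ⟨k, l⟩⟩ hp
    simp only [Finset.mem_sigma, Finset.HasAntidiagonal.mem_antidiagonal] at hp
    obtain ⟨rfl, rfl⟩ := hp
    rfl
  · rintro ⟨⟨i, j⟩, ⟨k, l⟩⟩ hp
    simp only [Finset.mem_sigma, Finset.HasAntidiagonal.mem_antidiagonal] at hp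
    obtain ⟨rfl, rfl⟩ := hp
    simp only [pow_add, RingHom.mul_def, RingHom.comp_apply, mul_assoc]

instance : Ring (SkewPowerSeries σ) where
  left_distrib f g h := by
    ext k
    simp only [coeff_mul, coeff_add, map_add, mul_add, Finset.sum_add_distrib]
  right_distrib f g h := by
    ext k
    simp only [coeff_mul, coeff_add, add_mul, Finset.sum_add_distrib]
  zero_mul f := by
    ext k
    simp only [coeff_mul, coeff_zero, zero_mul, Finset.sum_const_zero]
  mul_zero f := by
    ext k
    simp only [coeff_mul, coeff_zero, map_zero, mul_zero, Finset.sum_const_zero]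
  mul_assoc := SkewPowerSeries.mul_assoc
  one_mul f := by
    ext k
    rw [coeff_mul, Finset.sum_eq_single (0, k)]
    · simp [coeff_one]
    · rintro ⟨i, j⟩ hp hne
      simp only [Finset.HasAntidiagonal.mem_antidiagonal] at hp
      have : i ≠ 0 := by
        rintro rfl
        exact hne (by simpa using hp)
      simp [coeff_one, this]
    · simp
  mul_one f := by
    ext k
    rw [coeff_mul, Finset.sum_eq_single (k, 0)]
    · simp [coeff_one]
    · rintro ⟨i, j⟩ hp hne
      simp only [Finset.HasAntidiagonal.mem_antidiagonal] at hp
      have : j ≠ 0 := by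
        rintro rfl
        exact hne (by simpa using hp)
      simp [coeff_one, this]
    · simp
  neg_add_cancel := neg_add_cancel
  sub_eq_add_neg := sub_eq_add_neg
  zsmul := fun m f => m • f
  zsmul_zero' := SubNegMonoid.zsmul_zero'
  zsmul_succ' := SubNegMonoid.zsmul_succ'
  zsmul_neg' := SubNegMonoid.zsmul_neg'
  nsmul := fun m f => m • f
  nsmul_zero := AddMonoid.nsmul_zero
  nsmul_succ := AddMonoid.nsmul_succ

/-- The defining relation. -/
theorem X_mul_C (r : R) : (X * C r : SkewPowerSeries σ) = C (σ r) * X := by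
  ext k
  simp only [coeff_mul, coeff_X, coeff_C]
  rcases eq_or_ne k 1 with rfl | hk
  · rw [Finset.Nat.antidiagonal_succ]
    simp
  · rw [Finset.sum_eq_zero, Finset.sum_eq_zero]
    · rintro ⟨i, j⟩ hp
      simp only [Finset.HasAntidiagonal.mem_antidiagonal] at hp
      by_cases hi : i = 0
      · have : j ≠ 1 := by omega
        simp [this]
      · simp [hi]
    · rintro ⟨i, j⟩ hp
      simp only [Finset.HasAntidiagonal.mem_antidiagonal] at hp
      by_cases hi : i = 1
      · have : j ≠ 0 := by omega
        simp [this]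
      · simp [hi]

theorem exists_right_inverse (f : SkewPowerSeries σ) (hf : coeff 0 f = 1) :
    ∃ g : SkewPowerSeries σ, coeff 0 g = 1 ∧ f * g = 1 := by
  let step : (k : ℕ) → ((m : ℕ) → m < k → R) → R := fun k ih =>
    if k = 0 then 1 else
      -∑ i : Fin k, coeff (i + 1) f * (σ ^ ((i : ℕ) + 1)) (ih (k - (i + 1)) (by omega))
  let g : ℕ → R := fun k => WellFounded.fix Nat.lt_wfRel.wf step k
  have hg : ∀ k, g k = step k (fun m _ => g m) := fun k =>
    WellFounded.fix_eq Nat.lt_wfRel.wf step k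
  refine ⟨mk g, by simp [coeff_mk, hg 0, step], ?_⟩
  ext k
  rw [coeff_mul, coeff_one]
  simp only [coeff_mk]
  rw [Finset.Nat.sum_antidiagonal_eq_sum_range_succ
    (fun i j => coeff i f * (σ ^ i) (g j)), Finset.sum_range_succ']
  rw [hf, Nat.sub_zero, pow_zero, hg k]
  by_cases hk : k = 0
  · subst hk
    simp [step]
  · simp only [step, hk, if_false]
    rw [Finset.sum_range (fun i => coeff (i + 1) f * (σ ^ (i + 1)) (g (k - (i + 1))))]
    simp

/-- A series with constant term `1` is invertible, so that the inverses below are genuine. -/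
theorem isUnit_of_coeff_zero (f : SkewPowerSeries σ) (hf : coeff 0 f = 1) : IsUnit f := by
  obtain ⟨g, hg, hfg⟩ := exists_right_inverse f hf
  obtain ⟨h, _, hgh⟩ := exists_right_inverse g hg
  have : f = h := left_inv_eq_right_inv hfg hgh
  exact ⟨⟨f, g, hfg, this ▸ hgh⟩, rfl⟩

end SkewPowerSeries

noncomputable section

namespace TypeC

/-- The letters `1 ≺ 2 ≺ ⋯ ≺ n ≺ n̄ ≺ ⋯ ≺ 2̄ ≺ 1̄` with this total order. -/
abbrev Letter (n : ℕ) : Type := Fin n ⊕ₗ (Fin n)ᵒᵈ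

/-- The unbarred letter `k + 1`, for `k = 0, …, n - 1`. -/
def unbarred {n : ℕ} (k : Fin n) : Letter n := toLex (Sum.inl k)

/-- The barred letter with bar over `k + 1`, for `k = 0, …, n - 1`. -/
def barred {n : ℕ} (k : Fin n) : Letter n := toLex (Sum.inr (OrderDual.toDual k))

/-- The index of the letter `n`. -/
def lastIdx (n : ℕ) [NeZero n] : Fin n := ⟨n - 1, Nat.sub_lt (NeZero.pos n) Nat.one_pos⟩

/-- The letter `n`. -/
def letterN (n : ℕ) [NeZero n] : Letter n := unbarred (lastIdx n)

/-- The letter `n̄`. -/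
def letterNbar (n : ℕ) [NeZero n] : Letter n := barred (lastIdx n)

/-- The difference of the two sides of
`z_{i,a} z_{ī,a-2n+2i-4} = z_{i-1,a} z_{\overline{i-1},a-2n+2i-4}`, where `i = k + 1` and
the right-hand side is `1` for `i = 1`. -/
def relator (n : ℕ) (k : Fin n) (a : ℂ) : MvPolynomial (Letter n × ℂ) ℤ :=
  MvPolynomial.X (unbarred k, a) *
      MvPolynomial.X (barred k, a - 2 * (n : ℂ) + 2 * ((k : ℕ) + 1 : ℂ) - 4) -
    if h : (k : ℕ) = 0 then 1
    else
      MvPolynomial.X (unbarred ⟨k - 1, by omega⟩, a) *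
        MvPolynomial.X
          (barred ⟨k - 1, by omega⟩, a - 2 * (n : ℂ) + 2 * ((k : ℕ) + 1 : ℂ) - 4)

/-- The ideal generated by the relations. -/
def relIdeal (n : ℕ) : Ideal (MvPolynomial (Letter n × ℂ) ℤ) :=
  Ideal.span (Set.range fun p : Fin n × ℂ => relator n p.1 p.2)

/-- The commutative ring `𝒵` generated by the `z_{i,a}` with these relations. -/
abbrev ZRing (n : ℕ) : Type := MvPolynomial (Letter n × ℂ) ℤ ⧸ relIdeal n

/-- The generator `z_{i,a}`. -/
def z {n : ℕ} (i : Letter n) (a : ℂ) : ZRing n :=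
  Ideal.Quotient.mk (relIdeal n) (MvPolynomial.X (i, a))

/-- The substitution `z_{i,a} ↦ z_{i,a-2}` on polynomials. -/
def shiftPoly (n : ℕ) : MvPolynomial (Letter n × ℂ) ℤ →+* MvPolynomial (Letter n × ℂ) ℤ :=
  (MvPolynomial.rename fun p : Letter n × ℂ => (p.1, p.2 - 2)).toRingHom

theorem shiftPoly_relator (n : ℕ) (k : Fin n) (a : ℂ) :
    shiftPoly n (relator n k a) = relator n k (a - 2) := by
  have e : a - 2 * (n : ℂ) + 2 * ((k : ℕ) + 1 : ℂ) - 4 - 2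
      = a - 2 - 2 * (n : ℂ) + 2 * ((k : ℕ) + 1 : ℂ) - 4 := by ring
  unfold shiftPoly relator
  split_ifs <;> simp [e]

/-- The ring endomorphism `z_{i,a} ↦ z_{i,a-2}` of `𝒵`. -/
def shift (n : ℕ) : ZRing n →+* ZRing n :=
  Ideal.quotientMap (relIdeal n) (shiftPoly n) (by
    unfold relIdeal
    rw [Ideal.span_le]
    rintro _ ⟨⟨k, a⟩, rfl⟩
    change shiftPoly n (relator n k a) ∈
      Ideal.span (Set.range fun p : Fin n × ℂ => relator n p.1 p.2)
    rw [shiftPoly_relator]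
    exact Ideal.subset_span ⟨(k, a - 2), rfl⟩)

theorem shift_z {n : ℕ} (i : Letter n) (a : ℂ) : shift n (z i a) = z i (a - 2) := by
  simp [shift, z, shiftPoly]

/-- The non-commutative ring `𝒜` of formal power series in `X` over `𝒵`, with
`X z_{i,a} = z_{i,a-2} X`. -/
abbrev ARing (n : ℕ) : Type := SkewPowerSeries (shift n)

/-- `z_{i,a} X`. -/
def zX {n : ℕ} (i : Letter n) (a : ℂ) : ARing n := SkewPowerSeries.C (z i a) * SkewPowerSeries.X

/-- The generating series
`(1 - z_{1̄,a} X)⁻¹ ⋯ (1 - z_{n̄,a} X)⁻¹ (1 - z_{n,a} X z_{n̄,a} X)⁻¹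
(1 - z_{n,a} X)⁻¹ ⋯ (1 - z_{1,a} X)⁻¹`. -/
def H (n : ℕ) [NeZero n] (a : ℂ) : ARing n :=
  ((List.finRange n).map fun k => Ring.inverse (1 - zX (barred k) a)).prod *
    Ring.inverse (1 - zX (letterN n) a * zX (letterNbar n) a) *
    ((List.finRange n).reverse.map fun k => Ring.inverse (1 - zX (unbarred k) a)).prod

/-- All the factors that are inverted in `H` are invertible. -/
theorem isUnit_one_sub_zX {n : ℕ} (i : Letter n) (a : ℂ) : IsUnit (1 - zX i a) := by
  apply SkewPowerSeries.isUnit_of_coeff_zero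
  rw [sub_eq_add_neg, SkewPowerSeries.coeff_add]
  change _ + -SkewPowerSeries.coeff 0 (zX i a) = 1
  simp [zX, SkewPowerSeries.coeff_mul, SkewPowerSeries.coeff_one, SkewPowerSeries.coeff_X]

theorem isUnit_one_sub_zX_mul_zX {n : ℕ} (i j : Letter n) (a : ℂ) :
    IsUnit (1 - zX i a * zX j a) := by
  apply SkewPowerSeries.isUnit_of_coeff_zero
  rw [sub_eq_add_neg, SkewPowerSeries.coeff_add]
  change _ + -SkewPowerSeries.coeff 0 (zX i a * zX j a) = 1
  simp [zX, SkewPowerSeries.coeff_mul, SkewPowerSeries.coeff_one, SkewPowerSeries.coeff_X]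

/-- `h_{m,a}`: the coefficient of `X^m` in `H_a` for `m ≥ 0`, and `0` for `m < 0`. -/
def h (n : ℕ) [NeZero n] (m : ℤ) (a : ℂ) : ZRing n :=
  if m < 0 then 0 else SkewPowerSeries.coeff m.toNat (H n a)

/-- The Jacobi–Trudi determinant `det (h_{λ_i - μ_j - i + j, a + 2(λ_i - i)})_{1 ≤ i,j ≤ l(λ)}`.
Rows are numbered from `0` here, so that `λ_i` is `lam.rowLen (i - 1)`. -/
def chi (n : ℕ) [NeZero n] (lam mu : YoungDiagram) (a : ℂ) : ZRing n :=
  Matrix.det (Matrix.of fun i j : Fin (lam.colLen 0) =>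
    h n ((lam.rowLen i : ℤ) - (mu.rowLen j : ℤ) - (i : ℤ) + (j : ℤ))
      (a + 2 * ((lam.rowLen i : ℂ) - ((i : ℕ) + 1 : ℂ))))

/-- The boxes `(row, column)` of the skew diagram `λ/μ`, numbered from `0`. -/
def skewCells (lam mu : YoungDiagram) : Finset (ℕ × ℕ) := lam.cells \ mu.cells

/-- Tableaux of shape `λ/μ`: fillings of the boxes of `λ/μ` by letters. -/
abbrev Tableau (n : ℕ) (lam mu : YoungDiagram) : Type := ↥(skewCells lam mu) → Letter n

section Tableaux

variable {n : ℕ} {lam mu : YoungDiagram}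

/-- `(i, j)` is a box of `λ/μ` and `T(i, j) = x`. -/
def IsEntry (T : Tableau n lam mu) (i j : ℕ) (x : Letter n) : Prop :=
  ∃ hc : (i, j) ∈ skewCells lam mu, T ⟨(i, j), hc⟩ = x

/-- The monomial `z^T_a = ∏ z_{T(i,j), a + 2(j - i)}`. -/
def weight (T : Tableau n lam mu) (a : ℂ) : ZRing n :=
  ∏ c : ↥(skewCells lam mu), z (T c) (a + 2 * ((c.1.2 : ℂ) - (c.1.1 : ℂ)))

variable [NeZero n]

/-- The horizontal rule: two neighbours in a row are weakly increasing or equal to `(n̄, n)`, and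
no three consecutive entries of a row are `(n̄, n̄, n)` or `(n̄, n, n)`. -/
def HRule (T : Tableau n lam mu) : Prop :=
  (∀ i j x y, IsEntry T i j x → IsEntry T i (j + 1) y →
    x ≤ y ∨ (x = letterNbar n ∧ y = letterN n)) ∧
  (∀ i j,
    ¬(IsEntry T i j (letterNbar n) ∧ IsEntry T i (j + 1) (letterNbar n) ∧
        IsEntry T i (j + 2) (letterN n)) ∧
    ¬(IsEntry T i j (letterNbar n) ∧ IsEntry T i (j + 1) (letterN n) ∧
        IsEntry T i (j + 2) (letterN n)))

/-- The vertical rule: two neighbours in a column are strictly increasing, or both are `n` with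
`n̄` to the left of the lower one, or both are `n̄` with `n` to the right of the upper one. -/
def VRule (T : Tableau n lam mu) : Prop :=
  ∀ i j x y, IsEntry T i j x → IsEntry T (i + 1) j y →
    x < y ∨
    (x = letterN n ∧ y = letterN n ∧ ∃ j', j' + 1 = j ∧ IsEntry T (i + 1) j' (letterNbar n)) ∨
    (x = letterNbar n ∧ y = letterNbar n ∧ IsEntry T i (j + 1) (letterN n))

/-- HV-tableaux. -/
def IsHV (T : Tableau n lam mu) : Prop := HRule T ∧ VRule T

/-- The extra rule: whenever `k` consecutive columns `j, …, j + k - 1`, with `k` odd, have `n` in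
row `i` and `n̄` in row `i + 1`, then the entry to the right of the block in row `i` exists and is
`n`, or the entry to the left of the block in row `i + 1` exists and is `n̄`. -/
def ExtraRule (T : Tableau n lam mu) : Prop :=
  ∀ i j k : ℕ, Odd k →
    (∀ t < k, IsEntry T i (j + t) (letterN n) ∧ IsEntry T (i + 1) (j + t) (letterNbar n)) →
    IsEntry T i (j + k) (letterN n) ∨ ∃ j', j' + 1 = j ∧ IsEntry T (i + 1) j' (letterNbar n)

end Tableaux

open Classical in
/-- The set of all HV-tableaux of shape `λ/μ` that satisfy the extra rule. -/
def Tab (n : ℕ) [NeZero n] (lam mu : YoungDiagram) : Finset (Tableau n lam mu) :=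
  Finset.univ.filter fun T => IsHV T ∧ ExtraRule T

end TypeC

end

/-!
The determinant has two rows, and each product of two coefficients `h` is a sum over pairs of rows,
so the theorem is a statement about pairs of rows with a sign.

Expanding the inverses, `h_{m,a}` is the sum over the rows of length `m` that satisfy the horizontal
rule: such a row consists of weakly increasing unbarred letters, some *double steps* `n̄ n`, which
come from the quadratic factor, and weakly increasing barred letters (`coeff_H`). To make the rule a
condition on neighbours only, letters are replaced by ranks `1, …, n` (unbarred letters), `n + 1`
and `n + 2` (the first half `n̄` and the second half `n` of a double step), `n + 3, …, 2n + 2`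
(barred letters), and `0` and `2n + 3` stand for the void to the left and to the right of a row. A
row is then a sequence `ℕ → ℕ` of ranks in which neighbours are related by `Step`. The position of a
box is its content up to a constant, so entries of the two rows at the same position have the same
spectral parameter.

The second product of the determinant belongs to pairs of rows whose ends are interchanged. If both
rows can exchange their tails at some position, the exchange at the first such position is a weight
preserving bijection between the two kinds of pairs, so these pairs cancel
(`sum_sub_sum_eq_sum_not_cross`). What remains on the positive side are the pairs satisfying the
vertical rule (`not_cross_iff_separated`, `Separated.vFilling`, `VFilling.separated`). On the
negative side the rows have to change sides without ever admitting an exchange of tails, which is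
only possible within the double steps: the (possibly empty) run of double steps of one row is
strictly nested in that of the other row and has the other parity (`exists_nestedAt`).

Such a nested pair has alternating letters `n̄ n` in both rows in a common range. Collecting all `n`
in the first row and all `n̄` in the second row, and exchanging the rows to the right of it, gives a
pair that satisfies the vertical rule and has an odd block of columns with `n` above `n̄` which is
extended neither to the right nor to the left. This is a weight preserving bijection onto the pairs
violating the extra rule (`NestedAt.untangle_mem`, `OddBlockAt.tangle_mem`), and hence the
determinant is the sum over the pairs that satisfy it (`sum_sub_sum_eq_sum_separated`). The letters
at each position are only permuted throughout, so all cancellations happen between equal monomials.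
-/

noncomputable section

namespace TypeC

/-! ### Rows as words, and the exchange of tails -/

/-- `Step n u v`: the rank `u` may be followed by the rank `v` in a row. Ranks increase weakly,
except that a first half `n + 1` is always followed by a second half `n + 2`, which occurs only
there, and that a second half may be followed by another first half. -/
def Step (n u v : ℕ) : Prop :=
  (u = n + 1 ∧ v = n + 2) ∨
    (u ≠ n + 1 ∧ v ≠ n + 2 ∧ (u ≤ v ∨ (u = n + 2 ∧ v = n + 1)))

/-- `f` reads off a row occupying the positions `s ≤ x < e`: it is `0` to the left of the row, `u`
from position `e` on, and a word in the ranks `1, …, 2n + 2` in between, such that neighbours are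
related by `Step`. The junctions with the two ends are included, so that a row with `s > 0` cannot
begin with a second half, and `u` restricts the last entry. -/
structure IsWord (n s e u : ℕ) (f : ℕ → ℕ) : Prop where
  step : ∀ x < e, Step n (f x) (f (x + 1))
  zero : ∀ x < s, f x = 0
  letter : ∀ x, s ≤ x → x < e → 0 < f x ∧ f x ≤ 2 * n + 2
  last : ∀ x, e ≤ x → f x = u

theorem finite_setOf_isWord (n s e u : ℕ) : {f | IsWord n s e u f}.Finite := by
  refine (Set.finite_range fun (g : Fin e → Fin (2 * n + 3)) (x : ℕ) =>
    if hx : x < e then (g ⟨x, hx⟩ : ℕ) else u).subset ?_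
  intro f hf
  refine ⟨fun x => ⟨f x, ?_⟩, ?_⟩
  · rcases lt_or_ge (x : ℕ) s with hx | hx
    · rw [hf.zero x hx]; omega
    · have := hf.letter x hx x.2
      omega
  · ext x
    by_cases hx : x < e
    · simp [hx]
    · simp [hx, hf.last x (by omega)]

/-- The finite set of all `f` with `IsWord n s e u f`. -/
def words (n s e u : ℕ) : Finset (ℕ → ℕ) := (finite_setOf_isWord n s e u).toFinset

theorem mem_words {n s e u : ℕ} {f : ℕ → ℕ} : f ∈ words n s e u ↔ IsWord n s e u f := by
  simp [words]

/-- A complete row: to its right stands the rank `2n + 3`, which excludes only a first half as last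
entry. -/
abbrev IsRow (n s e : ℕ) (f : ℕ → ℕ) : Prop := IsWord n s e (2 * n + 3) f

section Row

variable {n s e : ℕ} {f : ℕ → ℕ}

theorem IsWord.row_start_le (hf : IsRow n s e f) : s ≤ e := by
  by_contra h
  have h1 := hf.zero e (by omega)
  have h2 := hf.last e le_rfl
  omega

theorem IsWord.row_cases (hf : IsRow n s e f) (x : ℕ) :
    (x < s ∧ f x = 0) ∨ (s ≤ x ∧ x < e ∧ 0 < f x ∧ f x ≤ 2 * n + 2) ∨
      (e ≤ x ∧ f x = 2 * n + 3) := by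
  rcases lt_or_ge x s with h | h
  · exact Or.inl ⟨h, hf.zero x h⟩
  · rcases lt_or_ge x e with h' | h'
    · exact Or.inr (Or.inl ⟨h, h', hf.letter x h h'⟩)
    · exact Or.inr (Or.inr ⟨h', hf.last x h'⟩)

theorem IsWord.row_step (hf : IsRow n s e f) (x : ℕ) : Step n (f x) (f (x + 1)) := by
  rcases lt_or_ge x e with h | h
  · exact hf.step x h
  · rw [hf.last x h, hf.last (x + 1) (by omega)]
    exact Or.inr ⟨by omega, by omega, Or.inl le_rfl⟩

end Row

/-- The function that agrees with `A` up to position `x` and with `B` afterwards. -/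
def splice (x : ℕ) (A B : ℕ → ℕ) (y : ℕ) : ℕ := if y ≤ x then A y else B y

theorem splice_of_le {x y : ℕ} (A B : ℕ → ℕ) (h : y ≤ x) : splice x A B y = A y := if_pos h

theorem splice_of_lt {x y : ℕ} (A B : ℕ → ℕ) (h : x < y) : splice x A B y = B y :=
  if_neg (by omega)

theorem splice_splice (x : ℕ) (A B : ℕ → ℕ) : splice x (splice x A B) (splice x B A) = A := by
  ext y
  simp only [splice]
  split_ifs <;> rfl

theorem IsWord.splice {n s t e e' u v x : ℕ} {A B : ℕ → ℕ} (hA : IsWord n s e u A)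
    (hB : IsWord n t e' v B) (hs : s ≤ x + 1) (ht : t ≤ x + 1) (he : x + 1 ≤ e)
    (he' : x + 1 ≤ e') (hstep : Step n (A x) (B (x + 1))) :
    IsWord n s e' v (splice x A B) where
  step y hy := by
    rcases lt_trichotomy y x with h | rfl | h
    · rw [splice_of_le _ _ h.le, splice_of_le _ _ (by omega : y + 1 ≤ x)]
      exact hA.step y (by omega)
    · rwa [splice_of_le _ _ le_rfl, splice_of_lt _ _ (by omega : y < y + 1)]
    · rw [splice_of_lt _ _ h, splice_of_lt _ _ (by omega : x < y + 1)]
      exact hB.step y hy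
  zero y hy := by
    rw [splice_of_le _ _ (by omega : y ≤ x)]
    exact hA.zero y hy
  letter y h1 h2 := by
    rcases le_or_gt y x with h | h
    · rw [splice_of_le _ _ h]
      exact hA.letter y h1 (by omega)
    · rw [splice_of_lt _ _ h]
      exact hB.letter y (by omega) h2
  last y hy := by
    rw [splice_of_lt _ _ (by omega : x < y)]
    exact hB.last y hy

/-- The two rows of `p` can exchange their tails after position `x`. Here `s` is the start of the
second row and `e` the end of the longer row; the bounds keep `x` between these two. -/
def Cross (n s e : ℕ) (p : (ℕ → ℕ) × (ℕ → ℕ)) (x : ℕ) : Prop :=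
  s ≤ x ∧ x + 1 < e ∧ Step n (p.1 x) (p.2 (x + 1)) ∧ Step n (p.2 x) (p.1 (x + 1))

/-- A filtered sum can be split along a key `k` that every index in question has exactly once. -/
theorem sum_filter_eq_sum_sum_filter {ι κ R : Type*} [AddCommMonoid R] (S : Finset ι)
    (K : Finset κ) (Q : ι → Prop) (P : κ → ι → Prop) [DecidablePred Q]
    [∀ k, DecidablePred (P k)] (f : ι → R)
    (hQ : ∀ i ∈ S, Q i ↔ ∃ k ∈ K, P k i)
    (huniq : ∀ i ∈ S, ∀ k k', P k i → P k' i → k = k') :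
    ∑ i ∈ S with Q i, f i = ∑ k ∈ K, ∑ i ∈ S with P k i, f i := by
  classical
  simp only [Finset.sum_filter]
  rw [Finset.sum_comm]
  refine Finset.sum_congr rfl fun i hi => ?_
  split_ifs with h
  · obtain ⟨k, hk, hkP⟩ := (hQ i hi).1 h
    rw [Finset.sum_eq_single k]
    · simp [hkP]
    · intro k' _ hne
      rw [if_neg fun h' => hne (huniq i hi _ _ h' hkP)]
    · exact fun h' => absurd hk h'
  · rw [Finset.sum_eq_zero]
    intro k hk
    rw [if_neg fun h' => h ((hQ i hi).2 ⟨k, hk, h'⟩)]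

section Pairs

variable {R : Type*} [CommRing R] (w : ℕ → ℕ → R) (N : ℕ)

/-- The product of the weights `w (f x) x` of the ranks of `f` at the positions `x < N`. -/
def wordWeight (f : ℕ → ℕ) : R := ∏ x ∈ Finset.range N, w (f x) x

/-- The weight of a pair of rows. -/
def pairWeight (p : (ℕ → ℕ) × (ℕ → ℕ)) : R := wordWeight w N p.1 * wordWeight w N p.2

theorem pairWeight_congr {p q : (ℕ → ℕ) × (ℕ → ℕ)}
    (h : ∀ x, w (p.1 x) x * w (p.2 x) x = w (q.1 x) x * w (q.2 x) x) :
    pairWeight w N p = pairWeight w N q := by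
  simp only [pairWeight, wordWeight, ← Finset.prod_mul_distrib]
  exact Finset.prod_congr rfl fun x _ => h x

/-- Exchange of the tails of two rows after position `x`. -/
def tailSwap (x : ℕ) (p : (ℕ → ℕ) × (ℕ → ℕ)) : (ℕ → ℕ) × (ℕ → ℕ) :=
  (splice x p.1 p.2, splice x p.2 p.1)

theorem tailSwap_tailSwap (x : ℕ) (p : (ℕ → ℕ) × (ℕ → ℕ)) : tailSwap x (tailSwap x p) = p :=
  Prod.ext (splice_splice x p.1 p.2) (splice_splice x p.2 p.1)

theorem pairWeight_tailSwap (x : ℕ) (p : (ℕ → ℕ) × (ℕ → ℕ)) :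
    pairWeight w N (tailSwap x p) = pairWeight w N p := by
  refine pairWeight_congr w N fun y => ?_
  simp only [tailSwap, splice]
  split_ifs
  · rfl
  · exact mul_comm _ _

variable {w N}

/-- Pairs of rows, the first on `s₁ ≤ x < e₁` and the second on `s₂ ≤ x < e₂`. -/
def rowPairs (n s₁ e₁ s₂ e₂ : ℕ) : Finset ((ℕ → ℕ) × (ℕ → ℕ)) :=
  words n s₁ e₁ (2 * n + 3) ×ˢ words n s₂ e₂ (2 * n + 3)

theorem mem_rowPairs {n s₁ e₁ s₂ e₂ : ℕ} {p : (ℕ → ℕ) × (ℕ → ℕ)} :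
    p ∈ rowPairs n s₁ e₁ s₂ e₂ ↔ IsRow n s₁ e₁ p.1 ∧ IsRow n s₂ e₂ p.2 := by
  simp [rowPairs, mem_words]

variable {n s₁ e₁ s₂ e₂ : ℕ}

/-- The position `x` is the first one at which the tails can be exchanged. -/
def FirstCross (n s e : ℕ) (x : ℕ) (p : (ℕ → ℕ) × (ℕ → ℕ)) : Prop :=
  Cross n s e p x ∧ ∀ y < x, ¬ Cross n s e p y

/-- After an exchange of tails at the first possible position, the same position is again the first
possible one: nothing changes before it, and there the exchange can be undone. Both assignments
of ends to the two rows are covered: `{E, E'}` consists of the longer end `e₁` and the other one. -/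
theorem tailSwap_mem {E E' x : ℕ} {p : (ℕ → ℕ) × (ℕ → ℕ)}
    (hE' : max E E' = e₁)
    (hp : p ∈ rowPairs n s₁ E s₂ E') (hx : FirstCross n s₂ e₁ x p) :
    tailSwap x p ∈ rowPairs n s₁ E' s₂ E ∧ FirstCross n s₂ e₁ x (tailSwap x p) := by
  rw [mem_rowPairs] at hp ⊢
  obtain ⟨hA, hB⟩ := hp
  obtain ⟨⟨h1, h2, h3, h4⟩, h5⟩ := hx
  have a0 := hA.row_cases x
  have a1 := hA.row_cases (x + 1)
  have b0 := hB.row_cases x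
  have b1 := hB.row_cases (x + 1)
  have lA := hA.row_start_le
  have lB := hB.row_start_le
  have k1 : s₁ ≤ x + 1 := by
    by_contra hlt
    unfold Step at h4
    omega
  have k2 : x + 1 ≤ E ∧ x + 1 ≤ E' := by
    unfold Step at h3 h4
    omega
  refine ⟨⟨hA.splice hB k1 (by omega) k2.1 k2.2 h3, hB.splice hA (by omega) k1 k2.2 k2.1 h4⟩,
    ⟨h1, h2, ?_, ?_⟩, ?_⟩
  · simp only [tailSwap, splice_of_le _ _ le_rfl, splice_of_lt _ _ (Nat.lt_succ_self x)]
    exact hA.row_step x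
  · simp only [tailSwap, splice_of_le _ _ le_rfl, splice_of_lt _ _ (Nat.lt_succ_self x)]
    exact hB.row_step x
  · intro y hy hc
    refine h5 y hy ?_
    simpa only [Cross, tailSwap, splice_of_le _ _ hy.le,
      splice_of_le _ _ (by omega : y + 1 ≤ x)] using hc

open Classical in
theorem sum_rowPairs_eq (f : (ℕ → ℕ) × (ℕ → ℕ) → R) (S : Finset ((ℕ → ℕ) × (ℕ → ℕ)))
    (s e : ℕ) :
    ∑ p ∈ S, f p = ∑ p ∈ S with ∀ x, ¬ Cross n s e p x, f p +
      ∑ x ∈ Finset.range e, ∑ p ∈ S with FirstCross n s e x p, f p := by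
  rw [← sum_filter_eq_sum_sum_filter S (Finset.range e) (fun p => ¬ ∀ x, ¬ Cross n s e p x)]
  · exact (Finset.sum_filter_add_sum_filter_not S _ f).symm
  · intro p _
    rw [_root_.not_forall_not]
    constructor
    · intro h
      exact ⟨Nat.find h, Finset.mem_range.2 (by have := (Nat.find_spec h).2.1; omega),
        Nat.find_spec h, fun y hy => Nat.find_min h hy⟩
    · rintro ⟨x, _, hx⟩
      exact ⟨x, hx.1⟩
  · intro p _ x y hx hy
    rcases lt_trichotomy x y with h | h | h
    · exact absurd hx.1 (hy.2 x h)
    · exact h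
    · exact absurd hy.1 (hx.2 y h)

open Classical in
/-- The exchange of tails at the first possible position cancels all pairs that admit one. -/
theorem sum_sub_sum_eq_sum_not_cross (he : e₂ < e₁) :
    ∑ p ∈ rowPairs n s₁ e₁ s₂ e₂, pairWeight w N p -
        ∑ p ∈ rowPairs n s₁ e₂ s₂ e₁, pairWeight w N p =
      ∑ p ∈ rowPairs n s₁ e₁ s₂ e₂ with ∀ x, ¬ Cross n s₂ e₁ p x, pairWeight w N p -
        ∑ p ∈ rowPairs n s₁ e₂ s₂ e₁ with ∀ x, ¬ Cross n s₂ e₁ p x, pairWeight w N p := by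
  rw [sum_rowPairs_eq (n := n) _ (rowPairs n s₁ e₁ s₂ e₂) s₂ e₁,
    sum_rowPairs_eq (n := n) _ (rowPairs n s₁ e₂ s₂ e₁) s₂ e₁]
  have : ∀ x, ∑ p ∈ rowPairs n s₁ e₁ s₂ e₂ with FirstCross n s₂ e₁ x p, pairWeight w N p =
      ∑ p ∈ rowPairs n s₁ e₂ s₂ e₁ with FirstCross n s₂ e₁ x p, pairWeight w N p := by
    intro x
    refine Finset.sum_nbij' (tailSwap x) (tailSwap x) ?_ ?_ (fun p _ => tailSwap_tailSwap x p)
      (fun p _ => tailSwap_tailSwap x p) fun p _ => (pairWeight_tailSwap w N x p).symm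
    · intro p hp
      rw [Finset.mem_filter] at hp ⊢
      exact tailSwap_mem (by omega) hp.1 hp.2
    · intro p hp
      rw [Finset.mem_filter] at hp ⊢
      exact tailSwap_mem (by omega) hp.1 hp.2
  simp only [this]
  abel

end Pairs

/-! ### Pairs of rows that admit no exchange of tails -/

/-- The relation between the ranks `a` (first row) and `b` (second row) at a common position as long
as the rows have not changed sides. -/
def Below (n a b : ℕ) : Prop := a < b ∨ (a = n + 2 ∧ b = n + 1)

/-- The relation between the ranks `a` (first row) and `b` (second row) at a common position after
the rows have changed sides. -/
def Passed (n a b : ℕ) : Prop := b < a ∧ n + 3 ≤ a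

/-- Where no exchange of tails is possible, the rows keep their sides, or the first row leaves the
double steps while the second one is in the middle of a double step. -/
theorem Below.step {n a b a' b' : ℕ} (h : Below n a b) (ha : Step n a a') (hb : Step n b b')
    (hc : ¬ (Step n a b' ∧ Step n b a')) :
    (Below n a' b' ∧ ¬ Step n b a') ∨
      (Passed n a' b' ∧ b' = n + 2 ∧ b = n + 1 ∧ (a ≤ n ∨ a = n + 2)) := by
  unfold Below Passed Step at *
  omega

/-- Where no exchange of tails is possible, rows that have changed sides do not change back. -/
theorem Passed.step {n a b a' b' : ℕ} (h : Passed n a b) (ha : Step n a a') (hb : Step n b b')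
    (hc : ¬ (Step n a b' ∧ Step n b a')) : Passed n a' b' ∧ ¬ Step n a b' := by
  unfold Passed Step at *
  omega

theorem IsWord.le_of_le {n s e : ℕ} {f : ℕ → ℕ} (hf : IsRow n s e f) {x y : ℕ} (hxy : x ≤ y)
    (hy : f y ≤ n) : f x ≤ n := by
  induction y, hxy using Nat.le_induction with
  | base => exact hy
  | succ y _ ih =>
    apply ih
    have := hf.row_step y
    unfold Step at this
    omega

theorem IsWord.ge_of_le {n s e : ℕ} {f : ℕ → ℕ} (hf : IsRow n s e f) {x y : ℕ} (hxy : x ≤ y)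
    (hx : n + 3 ≤ f x) : n + 3 ≤ f y := by
  induction y, hxy using Nat.le_induction with
  | base => exact hx
  | succ y _ ih =>
    have := hf.row_step y
    unfold Step at this
    omega

/-- The rank at distance `k` from the beginning of a run of double steps. -/
def alt (n k : ℕ) : ℕ := if k % 2 = 0 then n + 1 else n + 2

/-- No entry of the second row can be followed by the entry of the first row at the next position.
These two entries are vertical neighbours in the tableau, so this is the column rule. -/
def Separated (n s e : ℕ) (p : (ℕ → ℕ) × (ℕ → ℕ)) : Prop :=
  ∀ x, s ≤ x → x + 1 < e → ¬ Step n (p.2 x) (p.1 (x + 1))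

/-- The rows of `p` change sides at `k.2`: the first row enters the double steps at `k.1 + 1` and
leaves them at `k.2`, during which time the second row runs through the double steps with the other
parity, from `k.1` to `k.2`. -/
structure NestedAt (n s e : ℕ) (k : ℕ × ℕ) (p : (ℕ → ℕ) × (ℕ → ℕ)) : Prop where
  lt : k.1 < k.2
  odd : (k.2 - k.1) % 2 = 1
  fst_le : ∀ y ≤ k.1, p.1 y ≤ n
  fst_alt : ∀ y, k.1 < y → y < k.2 → p.1 y = alt n (y - (k.1 + 1))
  fst_ge : n + 3 ≤ p.1 k.2
  snd_alt : ∀ y, k.1 ≤ y → y ≤ k.2 → p.2 y = alt n (y - k.1)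
  before : ∀ x, s ≤ x → x < k.1 → ¬ Step n (p.2 x) (p.1 (x + 1))
  after : ∀ x, k.2 ≤ x → x + 1 < e → ¬ Step n (p.1 x) (p.2 (x + 1))

/-- At the positions `k.1 < y ≤ k.2` the first row has `n`, below entries `n̄` of the second row
(which are one position to the left), their number `k.2 - k.1` is odd, and the block extends neither
to the left nor to the right. -/
structure OddBlockAt (n : ℕ) (k : ℕ × ℕ) (p : (ℕ → ℕ) × (ℕ → ℕ)) : Prop where
  lt : k.1 < k.2
  odd : (k.2 - k.1) % 2 = 1
  fst_le : ∀ y ≤ k.2, p.1 y ≤ n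
  fst_eq : ∀ y, k.1 < y → y ≤ k.2 → p.1 y = n
  fst_gt : n < p.1 (k.2 + 1)
  snd_lt : ∀ y < k.1, p.2 y < n + 3
  snd_eq : ∀ y, k.1 ≤ y → y < k.2 → p.2 y = n + 3

section

variable {n s₁ e₁ s₂ e₂ : ℕ}

/-- Rows with the ends in the right order cannot have changed sides, for they could not change
back. -/
theorem not_cross_iff_separated (hs : s₂ < s₁) (he : e₂ < e₁) {p : (ℕ → ℕ) × (ℕ → ℕ)}
    (hp : p ∈ rowPairs n s₁ e₁ s₂ e₂) :
    (∀ x, ¬ Cross n s₂ e₁ p x) ↔ Separated n s₂ e₁ p := by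
  rw [mem_rowPairs] at hp
  obtain ⟨hA, hB⟩ := hp
  have lA := hA.row_start_le
  have lB := hB.row_start_le
  refine ⟨fun h => ?_, fun h x hx => h x hx.1 hx.2.1 hx.2.2.2⟩
  have hnc : ∀ x, s₂ ≤ x → x + 1 < e₁ →
      ¬ (Step n (p.1 x) (p.2 (x + 1)) ∧ Step n (p.2 x) (p.1 (x + 1))) :=
    fun x h1 h2 h3 => h x ⟨h1, h2, h3.1, h3.2⟩
  have not_passed : ∀ x, s₂ ≤ x → x < e₁ → ¬ Passed n (p.1 x) (p.2 x) := by
    intro x hx hxe hpass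
    have key : ∀ y, x ≤ y → y < e₁ → Passed n (p.1 y) (p.2 y) := by
      intro y hy
      induction y, hy using Nat.le_induction with
      | base => exact fun _ => hpass
      | succ y hy ih =>
        exact fun h' => ((ih (by omega)).step (hA.row_step y) (hB.row_step y)
          (hnc y (by omega) h')).1
    have := key (e₁ - 1) (by omega) (by omega)
    have a := hA.row_cases (e₁ - 1)
    have b := hB.last (e₁ - 1) (by omega)
    unfold Passed at this
    omega
  have below : ∀ x, s₂ ≤ x → x < e₁ → Below n (p.1 x) (p.2 x) := by
    intro x hx
    induction x, hx using Nat.le_induction with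
    | base =>
      intro _
      have a := hA.zero s₂ hs
      have b := hB.row_cases s₂
      unfold Below
      omega
    | succ x hx ih =>
      intro h'
      rcases (ih (by omega)).step (hA.row_step x) (hB.row_step x) (hnc x hx h') with h1 | h1
      · exact h1.1
      · exact absurd h1.1 (not_passed _ (by omega) h')
  intro x hx hxe
  rcases (below x hx (by omega)).step (hA.row_step x) (hB.row_step x) (hnc x hx hxe) with h1 | h1
  · exact h1.2
  · exact absurd h1.1 (not_passed _ (by omega) hxe)

/-- A second row in a first half while the first row has just completed a double step, or not yet
begun one: going back in time, the rows alternate in opposite parity until the first row enters. -/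
theorem exists_alternation {p : (ℕ → ℕ) × (ℕ → ℕ)} (hA : IsRow n s₁ e₂ p.1)
    (hB : IsRow n s₂ e₁ p.2) (hs : s₂ < s₁) :
    ∀ x, s₂ ≤ x → (∀ y, s₂ ≤ y → y ≤ x → Below n (p.1 y) (p.2 y)) →
      p.2 x = n + 1 → (p.1 x ≤ n ∨ p.1 x = n + 2) →
      ∃ k, s₂ ≤ k ∧ k ≤ x ∧ (x - k) % 2 = 0 ∧ p.1 k ≤ n ∧
        (∀ y, k < y → y ≤ x → p.1 y = alt n (y - (k + 1))) ∧
        ∀ y, k ≤ y → y ≤ x → p.2 y = alt n (y - k) := by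
  intro x
  induction x using Nat.strong_induction_on with
  | _ x ih =>
  intro hx hbel hb ha
  rcases ha with ha | ha
  · refine ⟨x, hx, le_rfl, by simp, ha, fun y _ _ => by omega, fun y h1 h2 => ?_⟩
    obtain rfl : y = x := by omega
    simp [hb, alt]
  · have a0 := hA.zero s₂ hs
    have hx1 : s₂ + 1 ≤ x := by
      by_contra h
      obtain rfl : x = s₂ := by omega
      omega
    obtain ⟨x, rfl⟩ : ∃ t, x = t + 1 := ⟨x - 1, by omega⟩
    have hA1 := hA.row_step x
    have hB1 := hB.row_step x
    have o1 := hbel x (by omega) (by omega)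
    have e1 : p.1 x = n + 1 ∧ p.2 x = n + 2 := by
      unfold Below at o1
      unfold Step at hA1 hB1
      omega
    have hx2 : s₂ + 1 ≤ x := by
      by_contra h
      obtain rfl : x = s₂ := by omega
      omega
    obtain ⟨x, rfl⟩ : ∃ t, x = t + 1 := ⟨x - 1, by omega⟩
    have hA2 := hA.row_step x
    have hB2 := hB.row_step x
    have e2 : (p.1 x ≤ n ∨ p.1 x = n + 2) ∧ p.2 x = n + 1 := by
      unfold Step at hA2 hB2
      omega
    obtain ⟨k, h1, h2, h3, h4, h5, h6⟩ := ih x (by omega) (by omega)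
      (fun y hy hy' => hbel y hy (by omega)) e2.2 e2.1
    refine ⟨k, h1, by omega, by omega, h4, fun y hy hy' => ?_, fun y hy hy' => ?_⟩
    · rcases Nat.lt_or_ge x y with h | h
      · unfold alt
        obtain rfl | rfl : y = x + 1 ∨ y = x + 1 + 1 := by omega
        · rw [if_pos (by omega)]; exact e1.1
        · rw [if_neg (by omega)]; exact ha
      · exact h5 y hy h
    · rcases Nat.lt_or_ge x y with h | h
      · unfold alt
        obtain rfl | rfl : y = x + 1 ∨ y = x + 1 + 1 := by omega
        · rw [if_neg (by omega)]; exact e1.2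
        · rw [if_pos (by omega)]; exact hb
      · exact h6 y hy h

theorem NestedAt.not_cross {p : (ℕ → ℕ) × (ℕ → ℕ)} {k : ℕ × ℕ}
    (h : NestedAt n s₂ e₁ k p) (x : ℕ) : ¬ Cross n s₂ e₁ p x := by
  rintro ⟨h1, h2, h3, h4⟩
  rcases lt_or_ge x k.1 with hx | hx
  · exact h.before x h1 hx h4
  rcases lt_or_ge x k.2 with hx' | hx'
  · have b0 := h.snd_alt x hx hx'.le
    have b1 := h.snd_alt (x + 1) (by omega) (by omega)
    rw [b0] at h4
    rw [b1] at h3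
    rcases Nat.eq_or_lt_of_le hx with rfl | hx
    · have := h.fst_le _ le_rfl
      simp [alt, Step] at h3
      omega
    · have a0 := h.fst_alt x hx hx'
      rw [a0] at h3
      unfold alt at h3
      unfold Step at h3
      split_ifs at h3 <;> omega
  · exact h.after x hx' h2 h3

/-- Rows with interchanged ends that admit no exchange of tails change sides at some point. -/
theorem exists_nestedAt (hs : s₂ < s₁) (he : e₂ < e₁) {p : (ℕ → ℕ) × (ℕ → ℕ)}
    (hp : p ∈ rowPairs n s₁ e₂ s₂ e₁) (h : ∀ x, ¬ Cross n s₂ e₁ p x) :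
    ∃ k : ℕ × ℕ, s₂ ≤ k.1 ∧ k.2 < e₁ ∧ NestedAt n s₂ e₁ k p := by
  rw [mem_rowPairs] at hp
  obtain ⟨hA, hB⟩ := hp
  have lA := hA.row_start_le
  have lB := hB.row_start_le
  have hnc : ∀ x, s₂ ≤ x → x + 1 < e₁ →
      ¬ (Step n (p.1 x) (p.2 (x + 1)) ∧ Step n (p.2 x) (p.1 (x + 1))) :=
    fun x h1 h2 h3 => h x ⟨h1, h2, h3.1, h3.2⟩
  have start : Below n (p.1 s₂) (p.2 s₂) := by
    have a := hA.zero s₂ hs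
    have b := hB.row_cases s₂
    unfold Below
    omega
  have ends : ∃ x, s₂ ≤ x ∧ x < e₁ ∧ ¬ Below n (p.1 x) (p.2 x) := by
    refine ⟨e₁ - 1, by omega, by omega, ?_⟩
    have a := hA.last (e₁ - 1) (by omega)
    have b := hB.row_cases (e₁ - 1)
    unfold Below
    omega
  classical
  obtain ⟨hq1, hq2, hq3⟩ := Nat.find_spec ends
  have hmin : ∀ y, s₂ ≤ y → y < Nat.find ends → Below n (p.1 y) (p.2 y) := by
    intro y hy hlt
    have := Nat.find_min ends hlt
    by_contra hb
    exact this ⟨hy, by omega, hb⟩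
  generalize Nat.find ends = q at hq1 hq2 hq3 hmin
  have hqs : q ≠ s₂ := by
    rintro rfl
    exact hq3 start
  obtain ⟨x, rfl⟩ : ∃ x, q = x + 1 := ⟨q - 1, by omega⟩
  have hx := (hmin x (by omega) (by omega)).step (hA.row_step x) (hB.row_step x)
    (hnc x (by omega) hq2)
  obtain ⟨hpass, hb', hb, ha⟩ := hx.resolve_left fun h' => hq3 h'.1
  obtain ⟨k, k1, k2, k3, k4, k5, k6⟩ := exists_alternation hA hB hs x (by omega)
    (fun y h1 h2 => hmin y h1 (by omega)) hb ha
  have passed : ∀ y, x + 1 ≤ y → y < e₁ → Passed n (p.1 y) (p.2 y) := by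
    intro y hy
    induction y, hy using Nat.le_induction with
    | base => exact fun _ => hpass
    | succ y hy ih =>
      exact fun h' => ((ih (by omega)).step (hA.row_step y) (hB.row_step y)
        (hnc y (by omega) h')).1
  refine ⟨(k, x + 1), k1, hq2, ⟨by simp only; omega, by simp only; omega,
    fun y hy => hA.le_of_le hy k4, fun y h1 h2 => k5 y h1 (by simp only at h2; omega), hpass.2,
    fun y h1 h2 => ?_, fun y h1 h2 => ?_, fun y h1 h2 => ?_⟩⟩
  · rcases Nat.eq_or_lt_of_le h2 with rfl | h2
    · rw [hb', alt, if_neg (by simp only; omega)]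
    · exact k6 y h1 (by simp only at h2; omega)
  · simp only at h2
    rcases (hmin y h1 (by omega)).step (hA.row_step y) (hB.row_step y)
      (hnc y h1 (by omega)) with h3 | h3
    · exact h3.2
    · have := hmin (y + 1) (by omega) (by omega)
      have := h3.1
      unfold Below Passed at *
      omega
  · exact ((passed y h1 (by omega)).step (hA.row_step y) (hB.row_step y)
      (hnc y (by simp only at h1; omega) h2)).2

theorem NestedAt.unique {p : (ℕ → ℕ) × (ℕ → ℕ)} {k l : ℕ × ℕ} (hA : IsRow n s₁ e₂ p.1)
    (hk : NestedAt n s₂ e₁ k p) (hl : NestedAt n s₂ e₁ l p) : k = l := by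
  have aux : ∀ {k l : ℕ × ℕ}, NestedAt n s₂ e₁ k p → NestedAt n s₂ e₁ l p →
      k.1 ≤ l.1 ∧ k.2 ≤ l.2 := by
    intro k l hk hl
    constructor
    · by_contra h
      have h1 := hk.fst_le (l.1 + 1) (by omega)
      rcases Nat.eq_or_lt_of_le (Nat.succ_le_of_lt hl.lt) with h2 | h2
      · have := hl.fst_ge
        rw [← h2] at this
        simp only [Nat.succ_eq_add_one] at this
        omega
      · rw [hl.fst_alt (l.1 + 1) (by omega) h2] at h1
        simp [alt] at h1
    · by_contra h
      have h1 := hA.ge_of_le (by omega : l.2 ≤ k.2 - 1) hl.fst_ge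
      rcases Nat.lt_or_ge k.1 (k.2 - 1) with h2 | h2
      · rw [hk.fst_alt _ h2 (by omega)] at h1
        unfold alt at h1
        split_ifs at h1 <;> omega
      · have := hk.fst_le _ h2
        omega
  have h1 := aux hk hl
  have h2 := aux hl hk
  exact Prod.ext (by omega) (by omega)

theorem OddBlockAt.unique {p : (ℕ → ℕ) × (ℕ → ℕ)} {k l : ℕ × ℕ}
    (hk : OddBlockAt n k p) (hl : OddBlockAt n l p) : k = l := by
  have aux : ∀ {k l : ℕ × ℕ}, OddBlockAt n k p → OddBlockAt n l p →
      k.1 ≤ l.1 ∧ k.2 ≤ l.2 := by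
    intro k l hk hl
    constructor
    · by_contra h
      have h1 := hk.snd_lt l.1 (by omega)
      have h2 := hl.snd_eq l.1 le_rfl hl.lt
      omega
    · by_contra h
      have h1 := hk.fst_le (l.2 + 1) (by omega)
      have h2 := hl.fst_gt
      omega
  have h1 := aux hk hl
  have h2 := aux hl hk
  exact Prod.ext (by omega) (by omega)

end

/-! ### The bijection between nested pairs and odd blocks -/

/-- From rows that change sides at `k` to rows with an odd block at `k`: the alternating double
steps `n̄ n` of both rows are sorted, with all `n` in the first and all `n̄` in the second row, and
the rows continue with exchanged tails. -/
def untangle (n : ℕ) (k : ℕ × ℕ) (p : (ℕ → ℕ) × (ℕ → ℕ)) : (ℕ → ℕ) × (ℕ → ℕ) :=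
  (fun y => if y ≤ k.1 then p.1 y else if y ≤ k.2 then n else p.2 y,
    fun y => if y < k.1 then p.2 y else if y < k.2 then n + 3 else p.1 y)

/-- The inverse of `untangle`: an odd block is rearranged into double steps in opposite parity, and
the tails are exchanged. -/
def tangle (n : ℕ) (k : ℕ × ℕ) (p : (ℕ → ℕ) × (ℕ → ℕ)) : (ℕ → ℕ) × (ℕ → ℕ) :=
  (fun y => if y ≤ k.1 then p.1 y else if y < k.2 then alt n (y - (k.1 + 1)) else p.2 y,
    fun y => if y < k.1 then p.2 y else if y ≤ k.2 then alt n (y - k.1) else p.1 y)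

section

variable {n s₁ e₁ s₂ e₂ : ℕ} {k : ℕ × ℕ} {p : (ℕ → ℕ) × (ℕ → ℕ)}

theorem NestedAt.tangle_untangle (h : NestedAt n s₂ e₁ k p) :
    tangle n k (untangle n k p) = p := by
  have hlt := h.lt
  refine Prod.ext (funext fun y => ?_) (funext fun y => ?_)
  · simp only [tangle, untangle]
    split_ifs
    all_goals first | rfl | omega | skip
    exact (h.fst_alt y (by omega) (by omega)).symm
  · simp only [tangle, untangle]
    split_ifs
    all_goals first | rfl | omega | skip
    exact (h.snd_alt y (by omega) (by omega)).symm

theorem OddBlockAt.untangle_tangle (h : OddBlockAt n k p) :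
    untangle n k (tangle n k p) = p := by
  have hlt := h.lt
  refine Prod.ext (funext fun y => ?_) (funext fun y => ?_)
  · simp only [tangle, untangle]
    split_ifs
    all_goals first | rfl | omega | skip
    exact (h.fst_eq y (by omega) (by omega)).symm
  · simp only [tangle, untangle]
    split_ifs
    all_goals first | rfl | omega | skip
    exact (h.snd_eq y (by omega) (by omega)).symm

/-- At every position the two letters are the same up to order. -/
theorem NestedAt.pairWeight_untangle {R : Type*} [CommRing R] {w : ℕ → ℕ → R} (N : ℕ)
    (hα : w (n + 1) = w (n + 3)) (hβ : w (n + 2) = w n) (h : NestedAt n s₂ e₁ k p) :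
    pairWeight w N (untangle n k p) = pairWeight w N p := by
  have hlt := h.lt
  have hodd := h.odd
  refine pairWeight_congr w N fun y => ?_
  simp only [untangle]
  by_cases h1 : y < k.1
  · rw [if_pos h1.le, if_pos h1]
  rw [if_neg h1]
  by_cases h2 : y ≤ k.1
  · obtain rfl : y = k.1 := by omega
    rw [if_pos h2, if_pos hlt, h.snd_alt _ le_rfl hlt.le]
    simp [alt, hα]
  rw [if_neg h2]
  by_cases h3 : y < k.2
  · rw [if_pos h3.le, if_pos h3, h.fst_alt y (by omega) h3, h.snd_alt y (by omega) h3.le]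
    unfold alt
    split_ifs
    · omega
    · rw [hα, hβ, mul_comm]
    · rw [hα, hβ]
    · omega
  rw [if_neg h3]
  by_cases h4 : y ≤ k.2
  · obtain rfl : y = k.2 := by omega
    rw [if_pos h4, h.snd_alt _ hlt.le le_rfl, alt, if_neg (by omega), hβ, mul_comm]
  · rw [if_neg h4, mul_comm]

theorem alt_cases (n t : ℕ) :
    (t % 2 = 0 ∧ alt n t = n + 1) ∨ (t % 2 = 1 ∧ alt n t = n + 2) := by
  unfold alt
  split_ifs <;> omega

theorem isRow_untangle_fst (hA : IsRow n s₁ e₂ p.1) (hB : IsRow n s₂ e₁ p.2) (hn : 0 < n)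
    (hlt : k.1 < k.2) (h1 : s₁ ≤ k.1 + 1) (h2 : k.1 < e₂) (h3 : s₂ ≤ k.2) (h4 : k.2 < e₁)
    (ha : p.1 k.1 ≤ n) (hb : p.2 k.2 = n + 2) : IsRow n s₁ e₁ (untangle n k p).1 where
  step y hy := by
    rcases (by omega : y + 1 ≤ k.1 ∨ y = k.1 ∨ (k.1 < y ∧ y < k.2) ∨ y = k.2 ∨ k.2 < y)
      with h | rfl | h | rfl | h
    all_goals
      simp only [untangle]
      split_ifs
      all_goals first | omega | skip
    · exact hA.row_step y
    all_goals first | exact hB.row_step _ | skip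
    · unfold Step; omega
    · unfold Step; omega
    · have b := hB.row_step k.2
      unfold Step at b ⊢
      omega
  zero y hy := by
    simp only [untangle]
    rw [if_pos (by omega)]
    exact hA.zero y hy
  letter y hy hy' := by
    simp only [untangle]
    split_ifs
    · exact hA.letter y hy (by omega)
    · omega
    · exact hB.letter y (by omega) hy'
  last y hy := by
    simp only [untangle]
    rw [if_neg (by omega), if_neg (by omega)]
    exact hB.last y hy

theorem isRow_untangle_snd (hA : IsRow n s₁ e₂ p.1) (hB : IsRow n s₂ e₁ p.2) (hn : 0 < n)
    (hlt : k.1 < k.2) (h1 : s₂ ≤ k.1) (h2 : k.1 < e₁) (h3 : s₁ ≤ k.2) (h4 : k.2 ≤ e₂)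
    (hb : p.2 k.1 = n + 1) (ha : n + 3 ≤ p.1 k.2) : IsRow n s₂ e₂ (untangle n k p).2 where
  step y hy := by
    rcases (by omega : y + 1 < k.1 ∨ y + 1 = k.1 ∨ (k.1 ≤ y ∧ y + 1 < k.2) ∨ y + 1 = k.2 ∨ k.2 ≤ y)
      with h | h | h | h | h
    all_goals
      simp only [untangle]
      split_ifs
      all_goals first | omega | skip
    · exact hB.row_step y
    all_goals first | exact hA.row_step y | skip
    · have b := hB.row_step y
      rw [h, hb] at b
      unfold Step at b ⊢
      omega
    · unfold Step; omega
    · rw [h]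
      unfold Step
      omega
  zero y hy := by
    simp only [untangle]
    rw [if_pos (by omega)]
    exact hB.zero y hy
  letter y hy hy' := by
    simp only [untangle]
    split_ifs
    · exact hB.letter y hy (by omega)
    · omega
    · exact hA.letter y (by omega) hy'
  last y hy := by
    simp only [untangle]
    rw [if_neg (by omega), if_neg (by omega)]
    exact hA.last y hy

theorem isRow_tangle_fst (hA : IsRow n s₁ e₁ p.1) (hB : IsRow n s₂ e₂ p.2)
    (hlt : k.1 < k.2) (hodd : (k.2 - k.1) % 2 = 1) (h1 : s₁ ≤ k.1 + 1) (h2 : k.1 < e₁)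
    (h3 : s₂ ≤ k.2) (h4 : k.2 ≤ e₂) (ha : p.1 k.1 ≤ n) (hb : n + 3 ≤ p.2 k.2) :
    IsRow n s₁ e₂ (tangle n k p).1 where
  step y hy := by
    have d := alt_cases n (y - (k.1 + 1))
    have d' := alt_cases n (y + 1 - (k.1 + 1))
    rcases (by omega : y + 1 ≤ k.1 ∨ y = k.1 ∨ (k.1 < y ∧ y + 1 < k.2) ∨ (k.1 < y ∧ y + 1 = k.2) ∨
      k.2 ≤ y) with h | rfl | h | h | h
    all_goals
      simp only [tangle]
      split_ifs
      all_goals first | omega | skip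
    · exact hA.row_step y
    all_goals first | exact hB.row_step y | skip
    · unfold Step; omega
    · have : k.1 + 1 = k.2 := by omega
      rw [this]
      unfold Step; omega
    · unfold Step; omega
    · rw [h.2]
      unfold Step; omega
  zero y hy := by
    simp only [tangle]
    rw [if_pos (by omega)]
    exact hA.zero y hy
  letter y hy hy' := by
    have d := alt_cases n (y - (k.1 + 1))
    simp only [tangle]
    split_ifs
    · exact hA.letter y hy (by omega)
    · omega
    · exact hB.letter y (by omega) hy'
  last y hy := by
    simp only [tangle]
    rw [if_neg (by omega), if_neg (by omega)]
    exact hB.last y hy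

theorem isRow_tangle_snd (hA : IsRow n s₁ e₁ p.1) (hB : IsRow n s₂ e₂ p.2)
    (hlt : k.1 < k.2) (hodd : (k.2 - k.1) % 2 = 1) (h1 : s₂ ≤ k.1) (h2 : k.1 < e₂)
    (h3 : s₁ ≤ k.2) (h4 : k.2 < e₁) (hb : p.2 k.1 = n + 3) (hb' : ∀ y < k.1, p.2 y < n + 3)
    (ha : p.1 k.2 = n) (ha' : n < p.1 (k.2 + 1)) :
    IsRow n s₂ e₁ (tangle n k p).2 where
  step y hy := by
    have d := alt_cases n (y - k.1)
    have d' := alt_cases n (y + 1 - k.1)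
    rcases (by omega : y + 1 < k.1 ∨ y + 1 = k.1 ∨ (k.1 ≤ y ∧ y < k.2) ∨ y = k.2 ∨ k.2 < y)
      with h | h | h | rfl | h
    all_goals
      simp only [tangle]
      split_ifs
      all_goals first | omega | skip
    · exact hB.row_step y
    all_goals first | exact hA.row_step y | skip
    · have b := hB.row_step y
      have b' := hb' y (by omega)
      rw [h, hb] at b
      unfold Step at b ⊢
      omega
    · unfold Step; omega
    · have a := hA.row_step k.2
      unfold Step at a ⊢
      omega
  zero y hy := by
    simp only [tangle]
    rw [if_pos (by omega)]
    exact hB.zero y hy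
  letter y hy hy' := by
    have d := alt_cases n (y - k.1)
    simp only [tangle]
    split_ifs
    · exact hB.letter y hy (by omega)
    · omega
    · exact hA.letter y (by omega) hy'
  last y hy := by
    simp only [tangle]
    rw [if_neg (by omega), if_neg (by omega)]
    exact hA.last y hy

theorem NestedAt.untangle_mem (hn : 0 < n)
    (hp : p ∈ rowPairs n s₁ e₂ s₂ e₁) (h : NestedAt n s₂ e₁ k p) :
    untangle n k p ∈ rowPairs n s₁ e₁ s₂ e₂ ∧ Separated n s₂ e₁ (untangle n k p) ∧
      OddBlockAt n k (untangle n k p) := by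
  rw [mem_rowPairs] at hp ⊢
  obtain ⟨hA, hB⟩ := hp
  have lA := hA.row_start_le
  have lB := hB.row_start_le
  have hlt := h.lt
  have hodd := h.odd
  have ai := h.fst_le _ le_rfl
  have aj := h.fst_ge
  have bi : p.2 k.1 = n + 1 := by rw [h.snd_alt _ le_rfl hlt.le]; simp [alt]
  have bj : p.2 k.2 = n + 2 := by rw [h.snd_alt _ hlt.le le_rfl, alt, if_neg (by omega)]
  have hi : s₂ ≤ k.1 ∧ k.1 < e₁ := by
    have := hB.row_cases k.1
    omega
  have hj : s₂ ≤ k.2 ∧ k.2 < e₁ := by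
    have := hB.row_cases k.2
    omega
  have hi' : s₁ ≤ k.1 + 1 := by
    rcases Nat.eq_or_lt_of_le (Nat.succ_le_of_lt hlt) with h1 | h1
    · have := hA.row_cases k.2
      omega
    · have h2 := h.fst_alt _ (Nat.lt_succ_self _) h1
      have h3 := alt_cases n (k.1.succ - (k.1 + 1))
      have := hA.row_cases k.1.succ
      omega
  have hi'' : k.1 < e₂ := by
    have := hA.row_cases k.1
    omega
  have hj' : k.2 ≤ e₂ := by
    rcases Nat.eq_or_lt_of_le (Nat.le_sub_one_of_lt hlt) with h1 | h1
    · omega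
    · have h2 := h.fst_alt _ h1 (by omega)
      have h3 := alt_cases n (k.2 - 1 - (k.1 + 1))
      have := hA.row_cases (k.2 - 1)
      omega
  refine ⟨⟨isRow_untangle_fst hA hB hn hlt hi' hi'' hj.1 hj.2 ai bj,
    isRow_untangle_snd hA hB hn hlt hi.1 hi.2 (by omega) hj' bi aj⟩, fun y hy hy' => ?_,
    ⟨hlt, hodd, fun y hy => ?_, fun y hy hy' => ?_, ?_, fun y hy => ?_, fun y hy hy' => ?_⟩⟩
  · rcases (by omega : y < k.1 ∨ (k.1 ≤ y ∧ y < k.2) ∨ k.2 ≤ y) with h1 | h1 | h1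
    · have := h.before y hy h1
      simp only [untangle]
      rwa [if_pos h1, if_pos (by omega)]
    · simp only [untangle]
      rw [if_neg (by omega), if_pos h1.2, if_neg (by omega), if_pos (by omega)]
      unfold Step
      omega
    · have := h.after y h1 hy'
      simp only [untangle]
      rwa [if_neg (by omega), if_neg (by omega), if_neg (by omega), if_neg (by omega)]
  · simp only [untangle]
    split_ifs with h1
    · exact h.fst_le y h1
    · exact le_rfl
  · simp only [untangle]
    rw [if_neg (by omega), if_pos hy']
  · have b := hB.row_step k.2
    unfold Step at b
    simp only [untangle]
    rw [if_neg (by omega), if_neg (by omega)]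
    omega
  · simp only [untangle]
    have b := hB.ge_of_le (x := y) (y := k.1) hy.le
    rw [if_pos hy]
    omega
  · simp only [untangle]
    rw [if_neg (by omega), if_pos hy']

theorem OddBlockAt.tangle_mem (hn : 0 < n)
    (hp : p ∈ rowPairs n s₁ e₁ s₂ e₂) (hsep : Separated n s₂ e₁ p) (h : OddBlockAt n k p) :
    tangle n k p ∈ rowPairs n s₁ e₂ s₂ e₁ ∧ NestedAt n s₂ e₁ k (tangle n k p) := by
  rw [mem_rowPairs] at hp ⊢
  obtain ⟨hA, hB⟩ := hp
  have lA := hA.row_start_le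
  have lB := hB.row_start_le
  have hlt := h.lt
  have hodd := h.odd
  have ai := h.fst_le k.1 hlt.le
  have ai' := h.fst_eq (k.1 + 1) (by omega) hlt
  have aj := h.fst_eq k.2 hlt le_rfl
  have bi := h.snd_eq k.1 le_rfl hlt
  have bj' := h.snd_eq (k.2 - 1) (by omega) (by omega)
  have bj := hB.ge_of_le (Nat.sub_le k.2 1) (by omega)
  have hi : s₂ ≤ k.1 ∧ k.1 < e₂ := by
    have := hB.row_cases k.1
    omega
  have hi' : s₁ ≤ k.1 + 1 := by
    have := hA.row_cases (k.1 + 1)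
    omega
  have hj : k.2 < e₁ := by
    have := hA.row_cases k.2
    omega
  have hj' : k.2 ≤ e₂ := by
    have := hB.row_cases (k.2 - 1)
    omega
  refine ⟨⟨isRow_tangle_fst hA hB hlt hodd hi' (by omega) (by omega) hj' ai bj,
    isRow_tangle_snd hA hB hlt hodd hi.1 hi.2 (by omega) hj bi h.snd_lt aj h.fst_gt⟩,
    ⟨hlt, hodd, fun y hy => ?_, fun y hy hy' => ?_, ?_, fun y hy hy' => ?_, fun y hy hy' => ?_,
      fun y hy hy' => ?_⟩⟩
  · simp only [tangle]
    rw [if_pos hy]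
    exact h.fst_le y (by omega)
  · simp only [tangle]
    rw [if_neg (by omega), if_pos hy']
  · simp only [tangle]
    rwa [if_neg (by omega), if_neg (by omega)]
  · simp only [tangle]
    rw [if_neg (by omega), if_pos hy']
  · have c := hsep y hy (by omega)
    simp only [tangle]
    rwa [if_pos hy', if_pos (by omega)]
  · have c := hsep y (by omega) hy'
    simp only [tangle]
    rwa [if_neg (by omega), if_neg (by omega), if_neg (by omega), if_neg (by omega)]

open Classical in
/-- The pairs with interchanged ends that survive the exchange of tails cancel against the column
strict pairs with an odd block. -/
theorem sum_sub_sum_eq_sum_separated {R : Type*} [CommRing R] {w : ℕ → ℕ → R} (N : ℕ)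
    (hn : 0 < n) (hα : w (n + 1) = w (n + 3)) (hβ : w (n + 2) = w n) (hs : s₂ < s₁) (he : e₂ < e₁) :
    ∑ p ∈ rowPairs n s₁ e₁ s₂ e₂, pairWeight w N p -
        ∑ p ∈ rowPairs n s₁ e₂ s₂ e₁, pairWeight w N p =
      ∑ p ∈ rowPairs n s₁ e₁ s₂ e₂ with
        Separated n s₂ e₁ p ∧ ¬ ∃ k, OddBlockAt n k p, pairWeight w N p := by
  rw [sum_sub_sum_eq_sum_not_cross he,
    Finset.filter_congr fun p hp => not_cross_iff_separated hs he hp,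
    ← Finset.sum_filter_add_sum_filter_not
      ((rowPairs n s₁ e₁ s₂ e₂).filter (Separated n s₂ e₁)) (fun p => ∃ k, OddBlockAt n k p),
    Finset.filter_filter, Finset.filter_filter, add_sub_right_comm, add_eq_right, sub_eq_zero]
  let K := Finset.range e₁ ×ˢ Finset.range e₁
  rw [sum_filter_eq_sum_sum_filter _ K _ (fun k p => Separated n s₂ e₁ p ∧ OddBlockAt n k p),
    sum_filter_eq_sum_sum_filter _ K _ (NestedAt n s₂ e₁)]
  · refine Finset.sum_congr rfl fun k _ => ?_
    refine Finset.sum_nbij' (tangle n k) (untangle n k) ?_ ?_ ?_ ?_ ?_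
    · intro p hp
      rw [Finset.mem_filter] at hp ⊢
      exact hp.2.2.tangle_mem hn hp.1 hp.2.1
    · intro p hp
      rw [Finset.mem_filter] at hp ⊢
      exact hp.2.untangle_mem hn hp.1
    · intro p hp
      exact (Finset.mem_filter.1 hp).2.2.untangle_tangle
    · intro p hp
      exact (Finset.mem_filter.1 hp).2.tangle_untangle
    · intro p hp
      rw [Finset.mem_filter] at hp
      have h := (hp.2.2.tangle_mem hn hp.1 hp.2.1).2.pairWeight_untangle N hα hβ
      rwa [hp.2.2.untangle_tangle] at h
  · intro p hp
    refine ⟨fun h => ?_, ?_⟩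
    · obtain ⟨k, h1, h2, h3⟩ := exists_nestedAt hs he hp h
      have := h3.lt
      exact ⟨k, by simp only [K, Finset.mem_product, Finset.mem_range]; omega, h3⟩
    · rintro ⟨k, _, hk⟩
      exact hk.not_cross
  · intro p hp k l hk hl
    exact hk.unique (mem_rowPairs.1 hp).1 hl
  · intro p hp
    refine ⟨fun ⟨h, k, hk⟩ => ⟨k, ?_, h, hk⟩, fun ⟨k, _, h, hk⟩ => ⟨h, k, hk⟩⟩
    have h1 := hk.lt
    have h2 := hk.fst_le _ le_rfl
    have h3 := (mem_rowPairs.1 hp).1.row_cases k.2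
    have h4 := (mem_rowPairs.1 hp).1.row_start_le
    simp only [K, Finset.mem_product, Finset.mem_range]
    omega
  · intro p _ k l hk hl
    exact hk.2.unique hl.2

end

/-! ### Coefficients of the generating series as sums over row words -/

section Peel

variable {R : Type*} [CommRing R]

/-- An empty row can stand to the left of every rank but a second half. -/
theorem sum_words_self {n s : ℕ} (hn : 0 < n) (hs : 0 < s) (u : ℕ) (W : ℕ → ℕ → R) :
    ∑ f ∈ words n s s u, ∏ x ∈ Finset.Ico s s, W (f x) x = if u = n + 2 then 0 else 1 := by
  simp only [Finset.Ico_self, Finset.prod_empty]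
  have hlt : s - 1 + 1 = s := by omega
  split_ifs with h
  · rw [Finset.sum_eq_zero]
    intro f hf
    rw [mem_words] at hf
    have := hf.step (s - 1) (by omega)
    rw [hlt, hf.zero (s - 1) (by omega), hf.last s le_rfl] at this
    unfold Step at this
    omega
  · rw [Finset.sum_eq_single_of_mem (fun x => if x < s then 0 else u)]
    · rw [mem_words]
      refine ⟨fun x hx => ?_, fun x hx => if_pos hx, fun x h1 h2 => by omega,
        fun x hx => if_neg (by omega)⟩
      unfold Step
      split_ifs <;> omega
    · intro f hf hne
      rw [mem_words] at hf
      refine absurd (funext fun x => ?_) hne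
      split_ifs with hx
      · exact hf.zero x hx
      · exact hf.last x (by omega)

open Classical in
/-- Splitting off the last entry of a row. -/
theorem sum_words_succ {n s e : ℕ} (hse : s ≤ e) (u : ℕ) (W : ℕ → ℕ → R) :
    ∑ f ∈ words n s (e + 1) u, ∏ x ∈ Finset.Ico s (e + 1), W (f x) x =
      ∑ j ∈ Finset.Icc 1 (2 * n + 2) with Step n j u,
        W j e * ∑ f ∈ words n s e j, ∏ x ∈ Finset.Ico s e, W (f x) x := by
  simp only [Finset.mul_sum]
  rw [Finset.sum_sigma']
  refine Finset.sum_nbij' (fun f => ⟨f e, fun x => if x ≤ e then f x else f e⟩)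
    (fun q => fun x => if x ≤ e then q.2 x else u) ?_ ?_ ?_ ?_ ?_
  · intro f hf
    rw [mem_words] at hf
    have h1 := hf.letter e hse (by omega)
    have h2 := hf.step e (by omega)
    rw [hf.last (e + 1) le_rfl] at h2
    simp only [Finset.mem_sigma, Finset.mem_filter, Finset.mem_Icc, mem_words]
    refine ⟨⟨⟨h1.1, h1.2⟩, h2⟩, fun x hx => ?_, fun x hx => ?_, fun x hx hx' => ?_,
      fun x hx => ?_⟩
    · rw [if_pos hx.le, if_pos (by omega)]
      exact hf.step x (by omega)
    · rw [if_pos (by omega)]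
      exact hf.zero x hx
    · rw [if_pos hx'.le]
      exact hf.letter x hx (by omega)
    · split_ifs with h
      · rw [le_antisymm h hx]
      · rfl
  · rintro ⟨j, g⟩ hq
    simp only [Finset.mem_sigma, Finset.mem_filter, Finset.mem_Icc, mem_words] at hq
    obtain ⟨⟨hj, hju⟩, hg⟩ := hq
    rw [mem_words]
    refine ⟨fun x hx => ?_, fun x hx => ?_, fun x hx hx' => ?_, fun x hx => ?_⟩ <;> dsimp only
    · rcases Nat.lt_or_ge x e with h | h
      · rw [if_pos h.le, if_pos (by omega)]
        exact hg.step x h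
      · rw [if_pos (by omega), if_neg (by omega), show g x = j from hg.last x h]
        exact hju
    · rw [if_pos (by omega)]
      exact hg.zero x hx
    · rw [if_pos (by omega)]
      rcases Nat.lt_or_ge x e with h | h
      · exact hg.letter x hx h
      · rw [show g x = j from hg.last x h]
        exact hj
    · rw [if_neg (by omega)]
  · intro f hf
    rw [mem_words] at hf
    funext x
    dsimp only
    split_ifs with h
    · rfl
    · exact (hf.last x (by omega)).symm
  · rintro ⟨j, g⟩ hq
    simp only [Finset.mem_sigma, mem_words] at hq
    have hj := hq.2.last e le_rfl
    refine Sigma.ext (by simpa using hj) (heq_of_eq (funext fun x => ?_))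
    dsimp only
    by_cases h : x ≤ e
    · rw [if_pos h, if_pos h]
    · rw [if_neg h, if_pos le_rfl, hj]
      exact (hq.2.last x (by omega)).symm
  · intro f _
    rw [Finset.prod_Ico_succ_top hse, mul_comm]
    congr 1
    refine Finset.prod_congr rfl fun x hx => ?_
    rw [Finset.mem_Ico] at hx
    dsimp only
    rw [if_pos (by omega)]

end Peel

section Coeff

variable {n : ℕ}

theorem coeff_zero_zX_mul (i : Letter n) (a : ℂ) (f : ARing n) :
    SkewPowerSeries.coeff 0 (zX i a * f) = 0 := by
  simp [zX, SkewPowerSeries.coeff_mul, SkewPowerSeries.coeff_X]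

theorem coeff_succ_zX_mul (k : ℕ) (i : Letter n) (a : ℂ) (f : ARing n) :
    SkewPowerSeries.coeff (k + 1) (zX i a * f) =
      z i a * shift n (SkewPowerSeries.coeff k f) := by
  have hX : ∀ m, SkewPowerSeries.coeff m (zX i a) = if m = 1 then z i a else 0 := by
    intro m
    rw [zX, SkewPowerSeries.coeff_mul, Finset.sum_eq_single (0, m)]
    · simp [SkewPowerSeries.coeff_C, SkewPowerSeries.coeff_X]
    · rintro ⟨b, c⟩ hp hne
      rw [Finset.HasAntidiagonal.mem_antidiagonal] at hp
      have : b ≠ 0 := by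
        rintro rfl
        exact hne (by simpa using hp)
      simp [SkewPowerSeries.coeff_C, this]
    · simp
  rw [SkewPowerSeries.coeff_mul, Finset.sum_eq_single (1, k)]
  · simp [hX]
  · rintro ⟨b, c⟩ hp hne
    rw [Finset.HasAntidiagonal.mem_antidiagonal] at hp
    have : b ≠ 1 := by
      rintro rfl
      exact hne (by simp only [Prod.mk.injEq, true_and]; simp only at hp; omega)
    simp [hX, this]
  · intro h
    exact absurd (Finset.HasAntidiagonal.mem_antidiagonal.2 (add_comm 1 k)) h

theorem inverse_one_sub_mul {R : Type*} [Ring R] {x : R} (hx : IsUnit (1 - x)) (g : R) :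
    Ring.inverse (1 - x) * g = g + x * (Ring.inverse (1 - x) * g) := by
  have h := Ring.mul_inverse_cancel _ hx
  have : (1 - x) * (Ring.inverse (1 - x) * g) = g := by rw [← mul_assoc, h, one_mul]
  rw [sub_mul, one_mul, sub_eq_iff_eq_add] at this
  exact this

end Coeff

section Series

variable {n : ℕ} [NeZero n]

/-- The letter of a rank `1 ≤ u ≤ 2n + 2`: `n̄` and `n` for the first and the second half of a
double step, the unbarred letter `u` for `u ≤ n`, and the letter `2n + 3 - u` with a bar for `u ≥ n
+ 3`. -/
def letterOf (n : ℕ) [NeZero n] (u : ℕ) : Letter n :=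
  if u = n + 1 then letterNbar n
  else if u = n + 2 then letterN n
  else if u ≤ n then unbarred (Fin.ofNat n (u - 1))
  else barred (Fin.ofNat n (2 * n + 2 - u))

/-- `(1 - z_{u,a} X)⁻¹ ⋯ (1 - z_{1,a} X)⁻¹`. -/
def lowSeries (n : ℕ) [NeZero n] (a : ℂ) : ℕ → ARing n
  | 0 => 1
  | u + 1 => Ring.inverse (1 - zX (letterOf n (u + 1)) a) * lowSeries n a u

/-- The part of the product `H` from the quadratic factor on. -/
def midSeries (n : ℕ) [NeZero n] (a : ℂ) : ARing n :=
  Ring.inverse (1 - zX (letterN n) a * zX (letterNbar n) a) * lowSeries n a n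

/-- The part of the product `H` consisting of the last `i` barred factors, the quadratic factor and
the unbarred ones. -/
def highSeries (n : ℕ) [NeZero n] (a : ℂ) : ℕ → ARing n
  | 0 => midSeries n a
  | i + 1 => Ring.inverse (1 - zX (letterOf n (n + 3 + i)) a) * highSeries n a i

/-- The generating series of the row words, read from right to left, that can stand to the left of
the rank `u`. -/
def leftSeries (n : ℕ) [NeZero n] (a : ℂ) (u : ℕ) : ARing n :=
  if u ≤ n then lowSeries n a u
  else if u = n + 1 then midSeries n a
  else if u = n + 2 then zX (letterNbar n) a * midSeries n a
  else highSeries n a (min (u - (n + 2)) n)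

theorem lowSeries_eq (a : ℂ) (u : ℕ) :
    lowSeries n a u = 1 + ∑ j ∈ Finset.Ico 1 (u + 1), zX (letterOf n j) a * lowSeries n a j := by
  induction u with
  | zero => simp [lowSeries]
  | succ u ih =>
    rw [Finset.sum_Ico_succ_top (by omega), ← add_assoc, ← ih]
    exact inverse_one_sub_mul (isUnit_one_sub_zX _ _) _

theorem midSeries_eq (a : ℂ) :
    midSeries n a = lowSeries n a n +
      zX (letterN n) a * (zX (letterNbar n) a * midSeries n a) := by
  rw [← mul_assoc]
  exact inverse_one_sub_mul (isUnit_one_sub_zX_mul_zX _ _ _) _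

theorem highSeries_eq (a : ℂ) (i : ℕ) :
    highSeries n a i = midSeries n a +
      ∑ j ∈ Finset.Ico (n + 3) (n + 3 + i),
        zX (letterOf n j) a * highSeries n a (j - (n + 2)) := by
  induction i with
  | zero => simp [highSeries]
  | succ i ih =>
    rw [← add_assoc, Finset.sum_Ico_succ_top (by omega), ← add_assoc, ← ih,
      show n + 3 + i - (n + 2) = i + 1 by omega]
    exact inverse_one_sub_mul (isUnit_one_sub_zX _ _) _

open Classical in
/-- A word to the left of `u` is empty or ends with an admissible rank `j`, to the left of which
stands another word. -/
theorem leftSeries_eq (a : ℂ) {u : ℕ} (hu : u ≤ 2 * n + 3) :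
    leftSeries n a u = (if u = n + 2 then 0 else 1) +
      ∑ j ∈ Finset.Icc 1 (2 * n + 2) with Step n j u,
        zX (letterOf n j) a * leftSeries n a j := by
  have low : ∀ v ≤ n, lowSeries n a v =
      1 + ∑ j ∈ Finset.Ico 1 (v + 1), zX (letterOf n j) a * leftSeries n a j := by
    intro v hv
    rw [lowSeries_eq]
    congr 1
    refine Finset.sum_congr rfl fun j hj => ?_
    rw [Finset.mem_Ico] at hj
    rw [leftSeries, if_pos (by omega)]
  have mid : midSeries n a = 1 + ∑ j ∈ insert (n + 2) (Finset.Ico 1 (n + 1)),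
      zX (letterOf n j) a * leftSeries n a j := by
    rw [Finset.sum_insert (by simp), midSeries_eq, low n le_rfl]
    have h1 : letterOf n (n + 2) = letterN n := by simp [letterOf]
    have h2 : leftSeries n a (n + 2) = zX (letterNbar n) a * midSeries n a := by
      simp [leftSeries]
    rw [h1, h2]
    abel
  rcases (by omega : u ≤ n ∨ u = n + 1 ∨ u = n + 2 ∨ n + 3 ≤ u) with h | rfl | rfl | h
  · have e : (Finset.Icc 1 (2 * n + 2)).filter (fun j => Step n j u) = Finset.Ico 1 (u + 1) := by
      ext j
      simp only [Finset.mem_filter, Finset.mem_Icc, Finset.mem_Ico]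
      unfold Step
      omega
    rw [e, if_neg (by omega), leftSeries, if_pos h]
    exact low u h
  · have e : (Finset.Icc 1 (2 * n + 2)).filter (fun j => Step n j (n + 1)) =
        insert (n + 2) (Finset.Ico 1 (n + 1)) := by
      have := NeZero.pos n
      ext j
      simp only [Finset.mem_filter, Finset.mem_Icc, Finset.mem_Ico, Finset.mem_insert]
      unfold Step
      omega
    rw [e, if_neg (by omega), leftSeries, if_neg (by omega), if_pos rfl]
    exact mid
  · have e : (Finset.Icc 1 (2 * n + 2)).filter (fun j => Step n j (n + 2)) = {n + 1} := by
      ext j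
      simp only [Finset.mem_filter, Finset.mem_Icc, Finset.mem_singleton]
      unfold Step
      omega
    rw [e, Finset.sum_singleton]
    simp [leftSeries, letterOf]
  · have e : (Finset.Icc 1 (2 * n + 2)).filter (fun j => Step n j u) =
        insert (n + 2) (Finset.Ico 1 (n + 1)) ∪
          Finset.Ico (n + 3) (n + 3 + min (u - (n + 2)) n) := by
      have := NeZero.pos n
      ext j
      simp only [Finset.mem_filter, Finset.mem_Icc, Finset.mem_Ico, Finset.mem_insert,
        Finset.mem_union]
      unfold Step
      omega
    rw [e, Finset.sum_union, ← add_assoc, if_neg (by omega), ← mid, leftSeries, if_neg (by omega),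
      if_neg (by omega), if_neg (by omega), highSeries_eq]
    · congr 1
      refine Finset.sum_congr rfl fun j hj => ?_
      rw [Finset.mem_Ico] at hj
      rw [leftSeries, if_neg (by omega), if_neg (by omega), if_neg (by omega),
        min_eq_left (by omega : j - (n + 2) ≤ n)]
    · rw [Finset.disjoint_left]
      intro j
      simp only [Finset.mem_insert, Finset.mem_Ico]
      omega

theorem H_eq_leftSeries (a : ℂ) : H n a = leftSeries n a (2 * n + 3) := by
  have hn := NeZero.pos n
  have hlow : ((List.finRange n).reverse.map fun k : Fin n =>
      Ring.inverse (1 - zX (unbarred k) a)).prod = lowSeries n a n := by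
    have aux : ∀ m, ((List.range m).reverse.map fun k =>
        Ring.inverse (1 - zX (letterOf n (k + 1)) a)).prod = lowSeries n a m := by
      intro m
      induction m with
      | zero => simp [lowSeries]
      | succ m ih => simp [List.range_succ, lowSeries, ← ih]
    rw [← aux n, ← List.map_coe_finRange_eq_range, ← List.map_reverse, List.map_map]
    congr 1
    refine List.map_congr_left fun k _ => ?_
    have hk := k.2
    have : letterOf n ((k : ℕ) + 1) = unbarred k := by
      rw [letterOf, if_neg (by omega), if_neg (by omega), if_pos (by omega)]
      congr 1
      ext
      simp
    simp [this]
  have hhigh : ((List.finRange n).map fun k : Fin n =>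
      Ring.inverse (1 - zX (barred k) a)).prod * midSeries n a = highSeries n a n := by
    have aux : ∀ m ≤ n, ((List.range m).map fun k =>
        Ring.inverse (1 - zX (letterOf n (2 * n + 2 - k)) a)).prod * highSeries n a (n - m) =
          highSeries n a n := by
      intro m
      induction m with
      | zero => simp
      | succ m ih =>
        intro hm
        rw [← ih (by omega), List.prod_range_succ, mul_assoc]
        obtain ⟨d, hd⟩ : ∃ d, n - m = d + 1 := ⟨n - m - 1, by omega⟩
        rw [hd, show n - (m + 1) = d by omega, highSeries,
          show 2 * n + 2 - m = n + 3 + d by omega]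
    have := aux n le_rfl
    rw [Nat.sub_self, highSeries] at this
    rw [← this, ← List.map_coe_finRange_eq_range, List.map_map]
    congr 2
    refine List.map_congr_left fun k _ => ?_
    have hk := k.2
    have : letterOf n (2 * n + 2 - (k : ℕ)) = barred k := by
      rw [letterOf, if_neg (by omega), if_neg (by omega), if_neg (by omega)]
      congr 1
      ext
      simp [show 2 * n + 2 - (2 * n + 2 - (k : ℕ)) = k by omega]
    simp [this]
  rw [H, hlow, mul_assoc]
  change _ * midSeries n a = _
  rw [hhigh, leftSeries, if_neg (by omega), if_neg (by omega), if_neg (by omega),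
    min_eq_right (by omega)]

/-- Reading from the right, each new position shifts the spectral parameter by `-2`, as does `X` in
the skew power series; `t` counts the positions already read. -/
theorem shift_pow_coeff_leftSeries (a : ℂ) {s : ℕ} (hs : 0 < s) (k : ℕ) :
    ∀ u ≤ 2 * n + 3, ∀ (t : ℕ) (c : ℂ), c + 2 * ((s + k : ℕ) : ℂ) - 2 = a - 2 * (t : ℂ) →
      (shift n ^ t) (SkewPowerSeries.coeff k (leftSeries n a u)) =
        ∑ f ∈ words n s (s + k) u, ∏ x ∈ Finset.Ico s (s + k),
          z (letterOf n (f x)) (c + 2 * (x : ℂ)) := by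
  classical
  have coeff_sum : ∀ (m : ℕ) (S : Finset ℕ) (g : ℕ → ARing n),
      SkewPowerSeries.coeff m (∑ j ∈ S, g j) = ∑ j ∈ S, SkewPowerSeries.coeff m (g j) := by
    intro m S g
    induction S using Finset.induction_on with
    | empty => rfl
    | insert j S hj ih => rw [Finset.sum_insert hj, Finset.sum_insert hj, ← ih]; rfl
  have shift_pow_z : ∀ (t : ℕ) (i : Letter n) (b : ℂ),
      (shift n ^ t) (z i b) = z i (b - 2 * (t : ℂ)) := by
    intro t i
    induction t with
    | zero => intro b; simp
    | succ t ih =>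
      intro b
      rw [pow_succ, RingHom.mul_def, RingHom.comp_apply, shift_z, ih]
      congr 1
      push_cast
      ring
  have hn := NeZero.pos n
  induction k with
  | zero =>
    intro u hu t c _
    rw [leftSeries_eq a hu, SkewPowerSeries.coeff_add, coeff_sum,
      Finset.sum_eq_zero fun j _ => coeff_zero_zX_mul _ _ _, add_zero]
    have := sum_words_self (n := n) (R := ZRing n) hn hs u
      (fun v x => z (letterOf n v) (c + 2 * (x : ℂ)))
    rw [add_zero, this]
    split_ifs
    · rw [SkewPowerSeries.coeff_zero, map_zero]
    · rw [SkewPowerSeries.coeff_one, if_pos rfl, map_one]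
  | succ k ih =>
    intro u hu t c hc
    have := sum_words_succ (n := n) (R := ZRing n) (Nat.le_add_right s k) u
      (fun v x => z (letterOf n v) (c + 2 * (x : ℂ)))
    rw [← add_assoc, this, leftSeries_eq a hu, SkewPowerSeries.coeff_add, coeff_sum]
    have h0 : SkewPowerSeries.coeff (k + 1) (if u = n + 2 then (0 : ARing n) else 1) = 0 := by
      split_ifs
      · rfl
      · rw [SkewPowerSeries.coeff_one, if_neg (by omega)]
    rw [h0, zero_add, map_sum]
    refine Finset.sum_congr rfl fun j hj => ?_
    simp only [Finset.mem_filter, Finset.mem_Icc] at hj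
    rw [coeff_succ_zX_mul, map_mul, shift_pow_z, ← ih j (by omega) (t + 1) c, pow_succ,
      RingHom.mul_def, RingHom.comp_apply]
    · congr 2
      rw [← hc]
      push_cast
      ring
    · push_cast at hc ⊢
      linear_combination hc

theorem coeff_H (b : ℂ) {s : ℕ} (hs : 0 < s) (k : ℕ) (c : ℂ)
    (hc : c + 2 * ((s + k : ℕ) : ℂ) - 2 = b) :
    SkewPowerSeries.coeff k (H n b) =
      ∑ f ∈ words n s (s + k) (2 * n + 3), ∏ x ∈ Finset.Ico s (s + k),
          z (letterOf n (f x)) (c + 2 * (x : ℂ)) := by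
  rw [H_eq_leftSeries, ← shift_pow_coeff_leftSeries b hs k _ le_rfl 0 c (by simpa using hc)]
  simp

end Series

/-! ### Rows of letters and rows with marked double steps -/

/-- The rank of the letter of `u`, with the halves of double steps no longer marked. -/
def base (n u : ℕ) : ℕ := if u = n + 1 then n + 3 else if u = n + 2 then n else u

/-- The marking of the double steps: an `n̄` (rank `n + 3`) followed by `n` becomes a first half,
and an `n` preceded by `n̄` becomes a second half. At position `0` there is no preceding entry. -/
def lift (n : ℕ) (f : ℕ → ℕ) (x : ℕ) : ℕ :=
  if f x = n + 3 ∧ f (x + 1) = n then n + 1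
  else if f x = n ∧ 1 ≤ x ∧ f (x - 1) = n + 3 then n + 2
  else f x

/-- `f` reads off a row of letters on `s ≤ x < e`, without marks for double steps and without any
condition on neighbours. -/
structure IsFilling (n s e : ℕ) (f : ℕ → ℕ) : Prop where
  start_le : s ≤ e
  zero : ∀ x < s, f x = 0
  letter : ∀ x, s ≤ x → x < e → 0 < f x ∧ f x ≤ 2 * n + 2 ∧ f x ≠ n + 1 ∧ f x ≠ n + 2
  last : ∀ x, e ≤ x → f x = 2 * n + 3

/-- The horizontal rule for a row of unmarked ranks. -/
def HFilling (n : ℕ) (f : ℕ → ℕ) : Prop :=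
  ∀ x, (f x ≤ f (x + 1) ∨ (f x = n + 3 ∧ f (x + 1) = n)) ∧
    ¬ (f x = n + 3 ∧ f (x + 1) = n + 3 ∧ f (x + 2) = n) ∧
    ¬ (f x = n + 3 ∧ f (x + 1) = n ∧ f (x + 2) = n)

/-- The vertical rule for two rows of unmarked ranks; the entry of `a` at `x + 1` stands above the
entry of `b` at `x`. -/
def VFilling (n s₁ e₁ s₂ e₂ : ℕ) (a b : ℕ → ℕ) : Prop :=
  ∀ x, s₁ ≤ x + 1 → x + 1 < e₁ → s₂ ≤ x → x < e₂ →
    a (x + 1) < b x ∨ (a (x + 1) = n ∧ b x = n ∧ 1 ≤ x ∧ b (x - 1) = n + 3) ∨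
      (a (x + 1) = n + 3 ∧ b x = n + 3 ∧ a (x + 2) = n)

/-- The extra rule for two rows of unmarked ranks; the block begins in column `j`, that is, at the
positions `j + 2` of `a` and `j + 1` of `b`. -/
def EFilling (n : ℕ) (a b : ℕ → ℕ) : Prop :=
  ∀ j k, Odd k → (∀ t < k, a (j + t + 2) = n ∧ b (j + t + 1) = n + 3) →
    a (j + k + 2) = n ∨ b j = n + 3

theorem base_cases (n u : ℕ) :
    (u = n + 1 ∧ base n u = n + 3) ∨ (u = n + 2 ∧ base n u = n) ∨
      (u ≠ n + 1 ∧ u ≠ n + 2 ∧ base n u = u) := by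
  unfold base
  split_ifs <;> omega

/-- A row with the marks of the double steps removed. -/
def baseRow (n : ℕ) (f : ℕ → ℕ) (x : ℕ) : ℕ := base n (f x)

theorem baseRow_cases (n : ℕ) (f : ℕ → ℕ) (x : ℕ) :
    (f x = n + 1 ∧ baseRow n f x = n + 3) ∨ (f x = n + 2 ∧ baseRow n f x = n) ∨
      (f x ≠ n + 1 ∧ f x ≠ n + 2 ∧ baseRow n f x = f x) :=
  base_cases n (f x)

theorem lift_cases (n : ℕ) (f : ℕ → ℕ) (x : ℕ) :
    (f x = n + 3 ∧ f (x + 1) = n ∧ lift n f x = n + 1) ∨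
      (f x = n ∧ (∃ y, x = y + 1 ∧ f y = n + 3) ∧ lift n f x = n + 2) ∨
      (¬ (f x = n + 3 ∧ f (x + 1) = n) ∧ (f x = n → ∀ y, x = y + 1 → f y ≠ n + 3) ∧
        lift n f x = f x) := by
  unfold lift
  split_ifs with h1 h2
  · exact Or.inl ⟨h1.1, h1.2, rfl⟩
  · exact Or.inr (Or.inl ⟨h2.1, ⟨x - 1, by omega, h2.2.2⟩, rfl⟩)
  · refine Or.inr (Or.inr ⟨h1, ?_, rfl⟩)
    rintro h y rfl hy
    exact h2 ⟨h, by omega, hy⟩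

section

variable {n s e : ℕ} {f : ℕ → ℕ}

theorem IsFilling.cases (hf : IsFilling n s e f) (x : ℕ) :
    (x < s ∧ f x = 0) ∨
      (s ≤ x ∧ x < e ∧ 0 < f x ∧ f x ≤ 2 * n + 2 ∧ f x ≠ n + 1 ∧ f x ≠ n + 2) ∨
      (e ≤ x ∧ f x = 2 * n + 3) := by
  rcases lt_or_ge x s with h | h
  · exact Or.inl ⟨h, hf.zero x h⟩
  · rcases lt_or_ge x e with h' | h'
    · exact Or.inr (Or.inl ⟨h, h', hf.letter x h h'⟩)
    · exact Or.inr (Or.inr ⟨h', hf.last x h'⟩)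

theorem IsFilling.base_lift (hf : IsFilling n s e f) (hn : 0 < n) (x : ℕ) :
    base n (lift n f x) = f x := by
  have a := hf.cases x
  unfold lift
  split_ifs with h1 h2
  · have := base_cases n (n + 1); omega
  · have := base_cases n (n + 2); omega
  · have := base_cases n (f x); omega

theorem IsFilling.isRow_lift (hf : IsFilling n s e f) (hn : 0 < n)
    (hH : HFilling n f) : IsRow n s e (lift n f) where
  step x _ := by
    have a0 := hf.cases x
    have a1 := hf.cases (x + 1)
    have h0 := (hH x).1
    rcases lift_cases n f x with ⟨p1, p2, p3⟩ | ⟨p1, ⟨y, hy, p2⟩, p3⟩ | ⟨p1, p2, p3⟩ <;>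
    rcases lift_cases n f (x + 1) with ⟨q1, q2, q3⟩ | ⟨q1, ⟨y', hy', q2⟩, q3⟩ | ⟨q1, q2, q3⟩ <;>
    rw [p3, q3] <;> unfold Step
    · omega
    · omega
    · exact absurd p1 (q2 p2 x rfl)
    · omega
    · obtain rfl : y' = x := by omega
      omega
    · subst hy
      have : ¬ (f y = n + 3 ∧ f (y + 1) = n ∧ f (y + 1 + 1) = n) := (hH y).2.2
      omega
    · have : ¬ (f x = n + 3 ∧ f (x + 1) = n + 3 ∧ f (x + 1 + 1) = n) := (hH x).2.1
      omega
    · obtain rfl : y' = x := by omega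
      omega
    · omega
  zero x hx := by
    have a := hf.zero x hx
    unfold lift
    rw [if_neg (by omega), if_neg (by omega), a]
  letter x hx hx' := by
    have a := hf.letter x hx hx'
    unfold lift
    split_ifs <;> omega
  last x hx := by
    have a := hf.last x hx
    unfold lift
    rw [if_neg (by omega), if_neg (by omega), a]

theorem IsWord.isFilling_base (hf : IsRow n s e f) (hn : 0 < n) :
    IsFilling n s e (baseRow n f) where
  start_le := hf.row_start_le
  zero x hx := by
    have a := hf.zero x hx
    have b := baseRow_cases n f x
    omega
  letter x hx hx' := by
    have a := hf.letter x hx hx'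
    have b := baseRow_cases n f x
    omega
  last x hx := by
    have a := hf.last x hx
    have b := baseRow_cases n f x
    omega

theorem IsWord.hFilling_base (hf : IsRow n s e f) : HFilling n (baseRow n f) := by
  intro x
  have a0 := hf.row_step x
  have a1 := hf.row_step (x + 1)
  have b0 := baseRow_cases n f x
  have b1 := baseRow_cases n f (x + 1)
  have b2 := baseRow_cases n f (x + 2)
  unfold Step at a0 a1
  simp only [add_assoc, Nat.reduceAdd] at a1
  refine ⟨?_, ?_, ?_⟩ <;> omega

theorem IsWord.lift_base (hf : IsRow n s e f) (hs : 0 < s) : lift n (baseRow n f) = f := by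
  funext x
  have a0 := hf.row_step x
  have b0 := baseRow_cases n f x
  have b1 := baseRow_cases n f (x + 1)
  rcases x with _ | x
  · have h0 := hf.zero 0 hs
    simp only [lift]
    unfold Step at a0
    split_ifs <;> omega
  · have a1 := hf.row_step x
    have b2 := baseRow_cases n f x
    unfold Step at a0 a1
    simp only [lift, Nat.add_sub_cancel]
    split_ifs <;> omega

end

section

variable {n s₁ e₁ s₂ e₂ : ℕ} {A B : ℕ → ℕ}

/-- The vertical rule at one column follows from `Separated` at this column and its two
neighbours. -/
theorem Separated.vFilling (hs : s₂ < s₁) (he : e₂ < e₁)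
    (hs₂ : 0 < s₂) (hA : IsRow n s₁ e₁ A) (hB : IsRow n s₂ e₂ B)
    (h : Separated n s₂ e₁ (A, B)) :
    VFilling n s₁ e₁ s₂ e₂ (baseRow n A) (baseRow n B) := by
  intro x h1 h2 h3 h4
  obtain ⟨y, rfl⟩ : ∃ y, x = y + 1 := ⟨x - 1, by omega⟩
  have c0 : ¬ Step n (B (y + 1)) (A (y + 2)) := h (y + 1) h3 h2
  have sa : Step n (A (y + 2)) (A (y + 3)) := hA.row_step (y + 2)
  have p1 := baseRow_cases n A (y + 2)
  have p2 := baseRow_cases n A (y + 3)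
  have q0 := baseRow_cases n B (y + 1)
  have q1 := baseRow_cases n B y
  change baseRow n A (y + 2) < _ ∨ (baseRow n A (y + 2) = n ∧ _ ∧ _ ∧ baseRow n B y = n + 3) ∨
    (baseRow n A (y + 2) = n + 3 ∧ _ ∧ baseRow n A (y + 3) = n)
  have sb : Step n (B (y + 1)) (B (y + 2)) := hB.row_step (y + 1)
  have sb' := hB.row_step y
  rcases q0 with ⟨q, q0⟩ | ⟨q, q0⟩ | ⟨q, q', q0⟩
  · rw [q] at c0 sb
    have e1 : B (y + 2) = n + 2 := by
      unfold Step at sb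
      omega
    have b1 := hB.row_cases (y + 2)
    have c1 : y + 3 < e₁ → ¬ Step n (B (y + 2)) (A (y + 3)) := h (y + 2) (by omega)
    rw [e1] at c1 b1
    replace c1 := c1 (by omega)
    clear b1 hA hB h
    rcases p1 with ⟨p, p1⟩ | ⟨p, p1⟩ | ⟨p, p', p1⟩
    · rw [p] at sa
      unfold Step at sa
      omega
    · rw [p] at c0
      unfold Step at c0
      omega
    · have : A (y + 2) ≤ n := by
        unfold Step at sa c1
        omega
      omega
  · rw [q] at c0 sb'
    have e1 : B y = n + 1 := by
      unfold Step at sb'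
      omega
    unfold Step at c0
    omega
  · rcases p1 with ⟨p, p1⟩ | ⟨p, p1⟩ | ⟨p, p', p1⟩
    · rw [p] at sa c0
      unfold Step at sa c0
      omega
    · have sa' : Step n (A (y + 1)) (A (y + 2)) := hA.row_step (y + 1)
      have c2 : s₂ ≤ y → y + 1 < e₁ → ¬ Step n (B y) (A (y + 1)) := h y
      have a1 := hA.row_cases (y + 1)
      rw [p] at sa'
      have e1 : A (y + 1) = n + 1 := by
        unfold Step at sa'
        omega
      rw [e1] at a1 c2
      have hgt : n < B (y + 1) := by
        by_contra hle
        have b0 := hB.le_of_le (Nat.le_add_right y 1) (by omega)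
        refine c2 (by omega) (by omega) (Or.inr ?_)
        omega
      omega
    · have hlt : A (y + 2) < B (y + 1) := by
        by_contra hge
        exact c0 (Or.inr ⟨q, p', Or.inl (by omega)⟩)
      left
      omega

/-- Conversely, `Separated` at one column follows from the vertical rule there, unless `n̄` in the
second row and `n` in the first row are halves of double steps; then the next column violates the
vertical rule. -/
theorem VFilling.separated (he : e₂ < e₁)
    (hs₂ : 0 < s₂) (hA : IsRow n s₁ e₁ A) (hB : IsRow n s₂ e₂ B)
    (h : VFilling n s₁ e₁ s₂ e₂ (baseRow n A) (baseRow n B)) :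
    Separated n s₂ e₁ (A, B) := by
  intro x h3 h2 hstep
  change Step n (B x) (A (x + 1)) at hstep
  have a1 := hA.row_cases (x + 1)
  have b0 := hB.row_cases x
  have h1 : s₁ ≤ x + 1 := by
    unfold Step at hstep
    omega
  have h4 : x < e₂ := by
    unfold Step at hstep
    omega
  have c0 := h x h1 h2 h3 h4
  have sa : Step n (A (x + 1)) (A (x + 2)) := hA.row_step (x + 1)
  have p1 := baseRow_cases n A (x + 1)
  have p2 := baseRow_cases n A (x + 2)
  have q0 := baseRow_cases n B x
  rcases c0 with c0 | ⟨c0, c1, -, c2⟩ | ⟨c0, c1, c2⟩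
  · have e0 : B x = n + 1 ∧ A (x + 1) = n + 2 := by
      unfold Step at hstep
      omega
    have sb := hB.row_step x
    rw [e0.1] at sb
    rw [e0.2] at sa
    have e1 : B (x + 1) = n + 2 := by
      unfold Step at sb
      omega
    have b1 := hB.row_cases (x + 1)
    have q1 := baseRow_cases n B (x + 1)
    have c1 : baseRow n A (x + 2) < baseRow n B (x + 1) ∨ (baseRow n A (x + 2) = n ∧
        baseRow n B (x + 1) = n ∧ 1 ≤ x + 1 ∧ baseRow n B x = n + 3) ∨
        (baseRow n A (x + 2) = n + 3 ∧ baseRow n B (x + 1) = n + 3 ∧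
          baseRow n A (x + 3) = n) :=
      h (x + 1) (by omega) (by omega) (by omega) (by omega)
    unfold Step at sa
    omega
  · obtain ⟨y, rfl⟩ : ∃ y, x = y + 1 := ⟨x - 1, by omega⟩
    have sb := hB.row_step y
    have q1 : (B y = n + 1 ∧ _) ∨ _ := baseRow_cases n B y
    rw [Nat.add_sub_cancel] at c2
    have e0 : B (y + 1) = n + 2 := by
      unfold Step at sb
      omega
    rw [e0] at hstep
    unfold Step at hstep
    omega
  · have e0 : A (x + 1) = n + 1 := by
      unfold Step at sa
      omega
    rw [e0] at hstep
    unfold Step at hstep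
    omega

/-- In a block violating the extra rule no entry belongs to a double step. -/
theorem eFilling_iff_not_oddBlockAt (hn : 0 < n) (hs : s₂ < s₁) (he : e₂ < e₁)
    (hs₂ : 0 < s₂) (hA : IsRow n s₁ e₁ A) (hB : IsRow n s₂ e₂ B)
    (hsep : Separated n s₂ e₁ (A, B)) :
    EFilling n (baseRow n A) (baseRow n B) ↔
      ¬ ∃ k, OddBlockAt n k (A, B) := by
  constructor
  · rintro h ⟨⟨i, j⟩, hk⟩
    have hlt := hk.lt
    have hodd := hk.odd
    have f1 : ∀ y, i < y → y ≤ j → A y = n := hk.fst_eq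
    have f2 : ∀ y, i ≤ y → y < j → B y = n + 3 := hk.snd_eq
    have f3 : n < A (j + 1) := hk.fst_gt
    have f4 : ∀ y < i, B y < n + 3 := hk.snd_lt
    simp only at hlt hodd
    have hi : 0 < i := by
      have := hB.row_cases i
      have := f2 i le_rfl hlt
      omega
    obtain ⟨i, rfl⟩ : ∃ t, i = t + 1 := ⟨i - 1, by omega⟩
    have h1 := h i (j - (i + 1)) (Nat.odd_iff.2 hodd) (fun t ht => ?_)
    · rw [show i + (j - (i + 1)) + 2 = j + 1 by omega] at h1
      have sA := hA.row_step j
      have sB := hB.row_step i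
      have := f1 j hlt le_rfl
      have := f2 (i + 1) le_rfl hlt
      have := f4 i (by omega)
      have := baseRow_cases n A (j + 1)
      have := baseRow_cases n B i
      unfold Step at sA sB
      omega
    · have := f1 (i + t + 2) (by omega) (by omega)
      have := f2 (i + t + 1) (by omega) (by omega)
      have := baseRow_cases n A (i + t + 2)
      have := baseRow_cases n B (i + t + 1)
      omega
  · intro h j k hk hblock
    by_contra hcon
    rw [not_or] at hcon
    obtain ⟨hr, hl⟩ := hcon
    have hk1 := Nat.odd_iff.1 hk
    apply h
    have hA' : ∀ t < k, A (j + t + 2) = n ∨ A (j + t + 2) = n + 2 := fun t ht => by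
      have := (hblock t ht).1
      have := baseRow_cases n A (j + t + 2)
      omega
    have hB' : ∀ t < k, B (j + t + 1) = n + 3 ∨ B (j + t + 1) = n + 1 := fun t ht => by
      have := (hblock t ht).2
      have := baseRow_cases n B (j + t + 1)
      omega
    have hl' : B j ≠ n + 3 ∧ B j ≠ n + 1 := by
      have := baseRow_cases n B j
      omega
    have hr' : A (j + k + 2) ≠ n ∧ A (j + k + 2) ≠ n + 2 := by
      have := baseRow_cases n A (j + k + 2)
      omega
    have fA : ∀ t < k, A (j + t + 2) = n := by
      intro t ht
      by_contra hne
      have e1 := (hA' t ht).resolve_left hne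
      have s1 := hA.row_step (j + t + 1)
      rw [show j + t + 1 + 1 = j + t + 2 by omega, e1] at s1
      have e0 : A (j + t + 1) = n + 1 := by
        unfold Step at s1
        omega
      rcases t with _ | t
      · rw [add_zero] at e0 e1
        have a1 := hA.row_cases (j + 1)
        have b0 := hB.row_cases j
        have b1 := hB.row_cases (j + 1)
        have sep0 : s₂ ≤ j → j + 1 < e₁ → ¬ Step n (B j) (A (j + 1)) := hsep j
        have sep1 : s₂ ≤ j + 1 → j + 2 < e₁ → ¬ Step n (B (j + 1)) (A (j + 2)) := hsep (j + 1)
        have a2 := hA.row_cases (j + 2)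
        have sB := hB.row_step j
        have h0 := hB' 0 hk.pos
        rw [add_zero] at h0
        rw [e0] at sep0 a1
        rw [e1] at sep1 a2
        rcases h0 with h0 | h0 <;> rw [h0] at sep1 sB b1 <;> unfold Step at sep0 sep1 sB <;> omega
      · have := hA' t (by omega)
        rw [show j + (t + 1) + 1 = j + t + 2 by omega] at e0
        omega
    have fB : ∀ t < k, B (j + t + 1) = n + 3 := by
      intro t ht
      by_contra hne
      have e1 := (hB' t ht).resolve_left hne
      have s1 := hB.row_step (j + t + 1)
      rw [show j + t + 1 + 1 = j + t + 2 by omega, e1] at s1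
      have e2 : B (j + t + 2) = n + 2 := by
        unfold Step at s1
        omega
      -- The partner of a first half lies outside the block, so this is its last column.
      have htk : t + 1 = k := by
        by_contra hlt
        have := hB' (t + 1) (by omega)
        rw [show j + (t + 1) + 1 = j + t + 2 by omega, e2] at this
        omega
      have a0 := fA t ht
      have sA := hA.row_step (j + t + 2)
      have b2 := hB.row_cases (j + t + 2)
      have sep := hsep (j + t + 2)
      rw [← htk, show j + (t + 1) + 2 = j + t + 2 + 1 by omega] at hr'
      simp only at sep
      rw [e2] at sep b2
      rw [a0] at sA
      unfold Step at sA sep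
      omega
    have sA := hA.row_step (j + k + 1)
    have sB := hB.row_step j
    have eA := fA (k - 1) (by omega)
    rw [show j + (k - 1) + 2 = j + k + 1 by omega] at eA
    have eB := fB 0 (by omega)
    rw [add_zero] at eB
    refine ⟨(j + 1, j + k + 1), by simp only; omega, by simp only; omega, fun y hy => ?_,
      fun y hy hy' => ?_, ?_, fun y hy => ?_, fun y hy hy' => ?_⟩
    · exact hA.le_of_le hy eA.le
    · simp only at hy hy'
      obtain ⟨t, rfl⟩ : ∃ t, y = j + t + 2 := ⟨y - j - 2, by omega⟩
      exact fA t (by omega)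
    · simp only
      rw [show j + k + 1 + 1 = j + k + 2 by omega] at sA ⊢
      unfold Step at sA
      omega
    · simp only at hy ⊢
      by_contra hge
      have := hB.ge_of_le (by omega : y ≤ j) (by omega)
      unfold Step at sB
      omega
    · simp only at hy hy'
      obtain ⟨t, rfl⟩ : ∃ t, y = j + t + 1 := ⟨y - j - 1, by omega⟩
      exact fB t (by omega)

end

/-! ### Ranks of letters and rows of a tableau -/

section Code

variable {n : ℕ}

/-- The rank of a letter; the ranks `n + 1` and `n + 2` are skipped. -/
def code (x : Letter n) : ℕ :=
  Sum.elim (fun k : Fin n => (k : ℕ) + 1)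
    (fun k : (Fin n)ᵒᵈ => 2 * n + 2 - ((OrderDual.ofDual k : Fin n) : ℕ)) (ofLex x)

theorem code_unbarred (k : Fin n) : code (unbarred k) = k + 1 := rfl

theorem code_barred (k : Fin n) : code (barred k) = 2 * n + 2 - k := rfl

theorem letter_cases (x : Letter n) : (∃ k, x = unbarred k) ∨ ∃ k, x = barred k := by
  rcases h : ofLex x with k | k
  · exact Or.inl ⟨k, congrArg toLex h⟩
  · exact Or.inr ⟨OrderDual.ofDual k, congrArg toLex h⟩

theorem code_range (x : Letter n) :
    0 < code x ∧ code x ≤ 2 * n + 2 ∧ code x ≠ n + 1 ∧ code x ≠ n + 2 := by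
  obtain ⟨k, rfl⟩ | ⟨k, rfl⟩ := letter_cases x
  · rw [code_unbarred]; have := k.2; omega
  · rw [code_barred]; have := k.2; omega

theorem code_strictMono : StrictMono (code (n := n)) := by
  intro x y hxy
  obtain ⟨k, rfl⟩ | ⟨k, rfl⟩ := letter_cases x <;> obtain ⟨l, rfl⟩ | ⟨l, rfl⟩ := letter_cases y
  · have : k < l := Sum.Lex.inl_lt_inl_iff.1 hxy
    rw [code_unbarred, code_unbarred]
    omega
  · rw [code_unbarred, code_barred]; omega
  · exact absurd hxy Sum.Lex.not_inr_lt_inl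
  · have : l < k := OrderDual.toDual_lt_toDual.1 (Sum.Lex.inr_lt_inr_iff.1 hxy)
    rw [code_barred, code_barred]
    omega

variable [NeZero n]

theorem code_letterN : code (letterN n) = n := by
  have := NeZero.pos n
  rw [letterN, code_unbarred, lastIdx]
  simp only
  omega

theorem code_letterNbar : code (letterNbar n) = n + 3 := by
  have := NeZero.pos n
  rw [letterNbar, code_barred, lastIdx]
  simp only
  omega

theorem code_eq_n {x : Letter n} : code x = n ↔ x = letterN n := by
  rw [← code_strictMono.injective.eq_iff, code_letterN]

theorem code_eq_n_add_three {x : Letter n} : code x = n + 3 ↔ x = letterNbar n := by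
  rw [← code_strictMono.injective.eq_iff, code_letterNbar]

theorem code_letterOf {u : ℕ} (h : 0 < u) (h' : u ≤ 2 * n + 2) :
    code (letterOf n u) = base n u := by
  unfold letterOf base
  split_ifs with h1 h2 h3
  · exact code_letterNbar
  · exact code_letterN
  · rw [code_unbarred, Fin.val_ofNat, Nat.mod_eq_of_lt (by omega)]
    omega
  · rw [code_barred, Fin.val_ofNat, Nat.mod_eq_of_lt (by omega)]
    omega

theorem letterOf_base (u : ℕ) : letterOf n (base n u) = letterOf n u := by
  have hn := NeZero.pos n
  unfold base
  split_ifs with h1 h2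
  · apply code_strictMono.injective
    rw [code_letterOf (by omega) (by omega), code_letterOf (by omega) (by omega), h1, base, base,
      if_neg (by omega), if_neg (by omega), if_pos rfl]
  · apply code_strictMono.injective
    rw [code_letterOf (by omega) (by omega), code_letterOf (by omega) (by omega), h2, base, base,
      if_neg (by omega), if_neg (by omega), if_neg (by omega), if_pos rfl]
  · rfl

theorem letterOf_code (x : Letter n) : letterOf n (code x) = x := by
  have h := code_range x
  apply code_strictMono.injective
  rw [code_letterOf h.1 h.2.1, base, if_neg h.2.2.1, if_neg h.2.2.2]

end Code

section Tab

variable {n : ℕ} {lam mu : YoungDiagram}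

theorem rowLen_le_rowLen (hmu : mu ≤ lam) (i : ℕ) : mu.rowLen i ≤ lam.rowLen i := by
  by_contra h
  have h1 : (i, lam.rowLen i) ∈ mu := YoungDiagram.mem_iff_lt_rowLen.2 (by omega)
  exact lt_irrefl _ (YoungDiagram.mem_iff_lt_rowLen.1 (hmu h1))

theorem mem_skewCells {i j : ℕ} :
    (i, j) ∈ skewCells lam mu ↔ mu.rowLen i ≤ j ∧ j < lam.rowLen i := by
  rw [skewCells, Finset.mem_sdiff, YoungDiagram.mem_cells, YoungDiagram.mem_cells,
    YoungDiagram.mem_iff_lt_rowLen, YoungDiagram.mem_iff_lt_rowLen]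
  omega

theorem lt_two_of_mem_skewCells (hlam : lam.colLen 0 = 2) {i j : ℕ}
    (hc : (i, j) ∈ skewCells lam mu) : i < 2 := by
  have h1 := (mem_skewCells.1 hc).2
  rw [← hlam, ← YoungDiagram.mem_iff_lt_colLen, YoungDiagram.mem_iff_lt_rowLen]
  omega

theorem IsEntry.lt_two (hlam : lam.colLen 0 = 2) {T : Tableau n lam mu} {i j : ℕ} {x : Letter n}
    (h : IsEntry T i j x) : i < 2 :=
  lt_two_of_mem_skewCells hlam h.1

/-- Row `i` of the tableau `T` as a sequence of ranks, column `j` being read at position `j + d`,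
with `0` to the left of the row and `2n + 3` to the right. -/
def filling (T : Tableau n lam mu) (i d x : ℕ) : ℕ :=
  if x < mu.rowLen i + d then 0
  else if h : (i, x - d) ∈ skewCells lam mu then code (T ⟨(i, x - d), h⟩)
  else 2 * n + 3

variable {T : Tableau n lam mu} {i d : ℕ}

theorem filling_of_isEntry {j : ℕ} {x : Letter n} (h : IsEntry T i j x) :
    filling T i d (j + d) = code x := by
  obtain ⟨hc, rfl⟩ := h
  have := mem_skewCells.1 hc
  rw [filling, if_neg (by omega), dif_pos (by simpa using hc)]
  simp only [Nat.add_sub_cancel]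

theorem exists_isEntry {x : ℕ} (h : 0 < filling T i d x ∧ filling T i d x ≤ 2 * n + 2) :
    ∃ j y, x = j + d ∧ IsEntry T i j y ∧ filling T i d x = code y := by
  unfold filling at h ⊢
  split_ifs at h ⊢ with h1 h2
  · omega
  · exact ⟨x - d, T ⟨(i, x - d), h2⟩, by omega, ⟨h2, rfl⟩, rfl⟩
  · omega

theorem filling_eq_code {j : ℕ} {x : Letter n} :
    filling T i d (j + d) = code x ↔ IsEntry T i j x := by
  refine ⟨fun h => ?_, filling_of_isEntry⟩
  have hx := code_range x
  obtain ⟨j', y, hj, hy, hxy⟩ := exists_isEntry (T := T) (i := i) (d := d) (x := j + d) (by omega)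
  obtain rfl : j = j' := by omega
  rwa [← code_strictMono.injective (hxy.symm.trans h)]

theorem isFilling_filling (hmu : mu.rowLen i ≤ lam.rowLen i) :
    IsFilling n (mu.rowLen i + d) (lam.rowLen i + d) (filling T i d) where
  start_le := by omega
  zero x hx := if_pos hx
  letter x hx hx' := by
    have h : (i, x - d) ∈ skewCells lam mu := mem_skewCells.2 (by omega)
    rw [filling, if_neg (by omega), dif_pos h]
    exact code_range _
  last x hx := by
    have h : (i, x - d) ∉ skewCells lam mu := by
      rw [mem_skewCells]
      omega
    rw [filling, if_neg (by omega), dif_neg h]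

variable [NeZero n]

theorem filling_eq_n {j : ℕ} : filling T i d (j + d) = n ↔ IsEntry T i j (letterN n) := by
  rw [← filling_eq_code (d := d), code_letterN]

theorem filling_eq_n_add_three {j : ℕ} :
    filling T i d (j + d) = n + 3 ↔ IsEntry T i j (letterNbar n) := by
  rw [← filling_eq_code (d := d), code_letterNbar]

theorem HRule.hFilling (hmu : mu ≤ lam) (d : ℕ) (hT : HRule T) (i : ℕ) :
    HFilling n (filling T i d) := by
  have hn := NeZero.pos n
  have hf := isFilling_filling (T := T) (d := d) (rowLen_le_rowLen hmu i)
  intro x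
  refine ⟨?_, ?_, ?_⟩
  · have c0 := hf.cases x
    have c1 := hf.cases (x + 1)
    by_cases h : (0 < filling T i d x ∧ filling T i d x ≤ 2 * n + 2) ∧
        0 < filling T i d (x + 1) ∧ filling T i d (x + 1) ≤ 2 * n + 2
    · obtain ⟨j, u, rfl, hu, e⟩ := exists_isEntry h.1
      obtain ⟨j', v, hj, hv, e'⟩ := exists_isEntry h.2
      obtain rfl : j' = j + 1 := by omega
      rw [e, e', code_strictMono.le_iff_le, code_eq_n, code_eq_n_add_three]
      exact hT.1 i j u v hu hv
    · have := hf.start_le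
      left
      omega
  · rintro ⟨h0, h1, h2⟩
    obtain ⟨j, u, rfl, hu, e⟩ := exists_isEntry (T := T) (i := i) (d := d) (x := x) (by omega)
    rw [show j + d + 1 = j + 1 + d by omega] at h1
    rw [show j + d + 2 = j + 2 + d by omega] at h2
    exact (hT.2 i j).1 ⟨filling_eq_n_add_three.1 h0, filling_eq_n_add_three.1 h1,
      filling_eq_n.1 h2⟩
  · rintro ⟨h0, h1, h2⟩
    obtain ⟨j, u, rfl, hu, e⟩ := exists_isEntry (T := T) (i := i) (d := d) (x := x) (by omega)
    rw [show j + d + 1 = j + 1 + d by omega] at h1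
    rw [show j + d + 2 = j + 2 + d by omega] at h2
    exact (hT.2 i j).2 ⟨filling_eq_n_add_three.1 h0, filling_eq_n.1 h1, filling_eq_n.1 h2⟩

theorem hRule_of_hFilling (hT : ∀ i, (∃ j x, IsEntry T i j x) → ∃ d, HFilling n (filling T i d)) :
    HRule T := by
  refine ⟨fun i j x y hx hy => ?_, fun i j => ⟨?_, ?_⟩⟩
  · obtain ⟨d, hd⟩ := hT i ⟨j, x, hx⟩
    have h := (hd (j + d)).1
    rw [filling_of_isEntry hx, add_right_comm, filling_of_isEntry hy, code_strictMono.le_iff_le,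
      code_eq_n, code_eq_n_add_three] at h
    exact h
  · rintro ⟨h0, h1, h2⟩
    obtain ⟨d, hd⟩ := hT i ⟨j, _, h0⟩
    refine (hd (j + d)).2.1 ⟨filling_eq_n_add_three.2 h0, ?_, ?_⟩
    · rw [show j + d + 1 = j + 1 + d by omega]
      exact filling_eq_n_add_three.2 h1
    · rw [show j + d + 2 = j + 2 + d by omega]
      exact filling_eq_n.2 h2
  · rintro ⟨h0, h1, h2⟩
    obtain ⟨d, hd⟩ := hT i ⟨j, _, h0⟩
    refine (hd (j + d)).2.2 ⟨filling_eq_n_add_three.2 h0, ?_, ?_⟩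
    · rw [show j + d + 1 = j + 1 + d by omega]
      exact filling_eq_n.2 h1
    · rw [show j + d + 2 = j + 2 + d by omega]
      exact filling_eq_n.2 h2

theorem vRule_iff_vFilling (hmu : mu ≤ lam) (hlam : lam.colLen 0 = 2) :
    VRule T ↔ VFilling n (mu.rowLen 0 + 2) (lam.rowLen 0 + 2) (mu.rowLen 1 + 1)
      (lam.rowLen 1 + 1) (filling T 0 2) (filling T 1 1) := by
  have hn := NeZero.pos n
  have hf0 := isFilling_filling (T := T) (d := 2) (rowLen_le_rowLen hmu 0)
  have hf1 := isFilling_filling (T := T) (d := 1) (rowLen_le_rowLen hmu 1)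
  have key : ∀ j x y, IsEntry T 0 j x → IsEntry T 1 j y →
      ((x < y ∨ (x = letterN n ∧ y = letterN n ∧ ∃ j', j' + 1 = j ∧
          IsEntry T 1 j' (letterNbar n)) ∨
        (x = letterNbar n ∧ y = letterNbar n ∧ IsEntry T 0 (j + 1) (letterN n))) ↔
      (filling T 0 2 (j + 1 + 1) < filling T 1 1 (j + 1) ∨
        (filling T 0 2 (j + 1 + 1) = n ∧ filling T 1 1 (j + 1) = n ∧ 1 ≤ j + 1 ∧
          filling T 1 1 (j + 1 - 1) = n + 3) ∨
        (filling T 0 2 (j + 1 + 1) = n + 3 ∧ filling T 1 1 (j + 1) = n + 3 ∧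
          filling T 0 2 (j + 1 + 2) = n))) := by
    intro j x y hx hy
    have e0 : filling T 0 2 (j + 1 + 1) = code x := filling_of_isEntry hx
    have e1 : filling T 1 1 (j + 1) = code y := filling_of_isEntry hy
    rw [e0, e1, code_strictMono.lt_iff_lt, code_eq_n, code_eq_n, code_eq_n_add_three,
      code_eq_n_add_three, filling_eq_n]
    have e2 : (∃ j', j' + 1 = j ∧ IsEntry T 1 j' (letterNbar n)) ↔
        1 ≤ j + 1 ∧ filling T 1 1 (j + 1 - 1) = n + 3 := by
      rw [Nat.add_sub_cancel]
      constructor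
      · rintro ⟨j', rfl, h⟩
        exact ⟨by omega, filling_eq_n_add_three.2 h⟩
      · rintro ⟨_, h⟩
        rcases j with _ | j'
        · have := hf1.zero 0 (by omega)
          omega
        · exact ⟨j', rfl, filling_eq_n_add_three.1 h⟩
    rw [e2]
  constructor
  · intro hT x h1 h2 h3 h4
    have c0 := hf0.letter (x + 1) h1 h2
    have c1 := hf1.letter x h3 h4
    obtain ⟨j, u, hj, hu, -⟩ := exists_isEntry (T := T) (i := 0) (d := 2) ⟨c0.1, c0.2.1⟩
    obtain ⟨j', v, hj', hv, -⟩ := exists_isEntry (T := T) (i := 1) (d := 1) ⟨c1.1, c1.2.1⟩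
    obtain rfl : j = j' := by omega
    subst hj'
    exact (key j u v hu hv).1 (hT 0 j u v hu hv)
  · intro h i j x y hx hy
    obtain rfl : i = 0 := by
      have := hy.lt_two hlam
      omega
    refine (key j x y hx hy).2 (h (j + 1) ?_ ?_ ?_ ?_)
    all_goals
      have := mem_skewCells.1 hx.1
      have := mem_skewCells.1 hy.1
      simp only [zero_add] at *
      omega

theorem extraRule_iff_eFilling (hmu : mu ≤ lam) (hlam : lam.colLen 0 = 2) :
    ExtraRule T ↔ EFilling n (filling T 0 2) (filling T 1 1) := by
  have hn := NeZero.pos n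
  have hf1 := isFilling_filling (T := T) (d := 1) (rowLen_le_rowLen hmu 1)
  have e2 : ∀ j, (∃ j', j' + 1 = j ∧ IsEntry T 1 j' (letterNbar n)) ↔
      filling T 1 1 j = n + 3 := by
    intro j
    constructor
    · rintro ⟨j', rfl, h⟩
      exact filling_eq_n_add_three.2 h
    · intro h
      rcases j with _ | j'
      · have := hf1.zero 0 (by omega)
        omega
      · exact ⟨j', rfl, filling_eq_n_add_three.1 h⟩
  have key : EFilling n (filling T 0 2) (filling T 1 1) ↔ ∀ j k, Odd k →
      (∀ t < k, IsEntry T 0 (j + t) (letterN n) ∧ IsEntry T 1 (j + t) (letterNbar n)) →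
      IsEntry T 0 (j + k) (letterN n) ∨ ∃ j', j' + 1 = j ∧ IsEntry T 1 j' (letterNbar n) := by
    simp only [EFilling, filling_eq_n, filling_eq_n_add_three, e2]
  rw [key]
  constructor
  · exact fun hT j k => hT 0 j k
  · intro h i j k hk hblock
    obtain rfl : i = 0 := by
      have := (hblock 0 hk.pos).2.lt_two hlam
      omega
    exact h j k hk hblock

end Tab

/-! ### Weights and the sum over tableaux -/

section Final

variable {n : ℕ} [NeZero n] {lam mu : YoungDiagram}

/-- The variable attached to the rank `u` at position `x`. Column `j` is read at position `j + 2` in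
the first and `j + 1` in the second row, so the spectral parameter `a + 2 (j - i)` is `a - 4 + 2 x`
in both. The ranks `0` and `2n + 3` outside of a row have weight `1`. -/
def letterWeight (n : ℕ) [NeZero n] (a : ℂ) (u x : ℕ) : ZRing n :=
  if 0 < u ∧ u ≤ 2 * n + 2 then z (letterOf n u) (a - 4 + 2 * (x : ℂ)) else 1

theorem letterWeight_congr (a : ℂ) {u v : ℕ} (hu : 0 < u ∧ u ≤ 2 * n + 2)
    (hv : 0 < v ∧ v ≤ 2 * n + 2) (h : base n u = base n v) :
    letterWeight n a u = letterWeight n a v := by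
  funext x
  rw [letterWeight, letterWeight, if_pos hu, if_pos hv, ← letterOf_base u, h, letterOf_base]

theorem IsWord.wordWeight_eq {s e N : ℕ} {f : ℕ → ℕ} (hf : IsRow n s e f) (he : e ≤ N) (a : ℂ) :
    wordWeight (letterWeight n a) N f =
      ∏ x ∈ Finset.Ico s e, z (letterOf n (f x)) (a - 4 + 2 * (x : ℂ)) := by
  rw [wordWeight, ← Finset.prod_subset (s₁ := Finset.Ico s e)]
  · refine Finset.prod_congr rfl fun x hx => ?_
    rw [Finset.mem_Ico] at hx
    rw [letterWeight, if_pos (hf.letter x hx.1 hx.2)]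
  · intro x hx
    rw [Finset.mem_Ico] at hx
    rw [Finset.mem_range]
    omega
  · intro x _ hx
    rw [Finset.mem_Ico] at hx
    have := hf.row_cases x
    rw [letterWeight, if_neg (by omega)]

theorem h_eq_sum_words {s e N : ℕ} (hs : 0 < s) (he : e ≤ N) (a b : ℂ)
    (hb : b = a - 4 + 2 * (e : ℂ) - 2) (m : ℤ) (hm : m = (e : ℤ) - (s : ℤ)) :
    h n m b = ∑ f ∈ words n s e (2 * n + 3), wordWeight (letterWeight n a) N f := by
  rw [h]
  split_ifs with hneg
  · rw [Finset.sum_eq_zero]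
    intro f hf
    have := (mem_words.1 hf).row_start_le
    omega
  · obtain ⟨k, rfl⟩ : ∃ k, e = s + k := ⟨e - s, by omega⟩
    rw [show m.toNat = k by omega, coeff_H b hs k (a - 4) hb.symm]
    exact Finset.sum_congr rfl fun f hf => ((mem_words.1 hf).wordWeight_eq he a).symm

/-- The tableau whose rows are the two rows of `p`. -/
def toTableau (lam mu : YoungDiagram) (p : (ℕ → ℕ) × (ℕ → ℕ)) : Tableau n lam mu :=
  fun c => letterOf n (if c.1.1 = 0 then p.1 (c.1.2 + 2) else p.2 (c.1.2 + 1))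

/-- The two rows of a tableau, with double steps marked. -/
def toPair (T : Tableau n lam mu) : (ℕ → ℕ) × (ℕ → ℕ) :=
  (lift n (filling T 0 2), lift n (filling T 1 1))

theorem filling_eq_baseRow {T : Tableau n lam mu} {i d : ℕ} {f : ℕ → ℕ}
    (hf : IsRow n (mu.rowLen i + d) (lam.rowLen i + d) f)
    (hT : ∀ j (hc : (i, j) ∈ skewCells lam mu), T ⟨(i, j), hc⟩ = letterOf n (f (j + d))) :
    filling T i d = baseRow n f := by
  have hn := NeZero.pos n
  funext x
  have hg := hf.isFilling_base hn
  unfold filling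
  split_ifs with h1 h2
  · exact (hg.zero x h1).symm
  · have h3 := mem_skewCells.1 h2
    have h4 := hf.letter x (by omega) (by omega)
    rw [hT, show x - d + d = x by omega, code_letterOf h4.1 h4.2]
    rfl
  · rw [mem_skewCells] at h2
    exact (hg.last x (by omega)).symm

theorem weight_toTableau (hlam : lam.colLen 0 = 2) (a : ℂ) {N : ℕ} (h0 : lam.rowLen 0 + 2 ≤ N)
    (h1 : lam.rowLen 1 + 1 ≤ N) {p : (ℕ → ℕ) × (ℕ → ℕ)}
    (hp : p ∈ rowPairs n (mu.rowLen 0 + 2) (lam.rowLen 0 + 2) (mu.rowLen 1 + 1)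
      (lam.rowLen 1 + 1)) :
    weight (toTableau lam mu p) a = pairWeight (letterWeight n a) N p := by
  rw [mem_rowPairs] at hp
  rw [pairWeight, hp.1.wordWeight_eq h0, hp.2.wordWeight_eq h1]
  let g : ℕ × ℕ → ZRing n := fun c =>
    z (letterOf n (if c.1 = 0 then p.1 (c.2 + 2) else p.2 (c.2 + 1)))
      (a + 2 * ((c.2 : ℂ) - (c.1 : ℂ)))
  have e : skewCells lam mu =
      (Finset.Ico (mu.rowLen 0 + 2) (lam.rowLen 0 + 2)).image (fun x => (0, x - 2)) ∪
        (Finset.Ico (mu.rowLen 1 + 1) (lam.rowLen 1 + 1)).image (fun x => (1, x - 1)) := by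
    ext ⟨i, j⟩
    simp only [Finset.mem_union, Finset.mem_image, Finset.mem_Ico, Prod.mk.injEq]
    constructor
    · intro hc
      have h2 := lt_two_of_mem_skewCells hlam hc
      have h3 := mem_skewCells.1 hc
      rcases (by omega : i = 0 ∨ i = 1) with rfl | rfl
      · exact Or.inl ⟨j + 2, by omega, rfl, by omega⟩
      · exact Or.inr ⟨j + 1, by omega, rfl, by omega⟩
    · rintro (⟨x, hx, rfl, rfl⟩ | ⟨x, hx, rfl, rfl⟩)
      · exact mem_skewCells.2 (by omega)
      · exact mem_skewCells.2 (by omega)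
  have hw : weight (toTableau lam mu p) a = ∏ c ∈ skewCells lam mu, g c :=
    Finset.prod_coe_sort (skewCells lam mu) g
  rw [hw, e, Finset.prod_union, Finset.prod_image, Finset.prod_image]
  · congr 1
    · refine Finset.prod_congr rfl fun x hx => ?_
      rw [Finset.mem_Ico] at hx
      obtain ⟨y, rfl⟩ : ∃ y, x = y + 2 := ⟨x - 2, by omega⟩
      simp only [g, if_true, Nat.add_sub_cancel]
      congr 1
      push_cast
      ring
    · refine Finset.prod_congr rfl fun x hx => ?_
      rw [Finset.mem_Ico] at hx
      obtain ⟨y, rfl⟩ : ∃ y, x = y + 1 := ⟨x - 1, by omega⟩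
      simp only [g, one_ne_zero, if_false, Nat.add_sub_cancel]
      congr 1
      push_cast
      ring
  · intro x hx y hy hxy
    simp only [Finset.coe_Ico, Set.mem_Ico, Prod.mk.injEq, true_and] at hx hy hxy
    omega
  · intro x hx y hy hxy
    simp only [Finset.coe_Ico, Set.mem_Ico, Prod.mk.injEq, true_and] at hx hy hxy
    omega
  · rw [Finset.disjoint_left]
    intro c hc hc'
    simp only [Finset.mem_image] at hc hc'
    obtain ⟨x, _, rfl⟩ := hc
    obtain ⟨y, _, hy⟩ := hc'
    simp at hy

open Classical in
/-- The tableaux in question are the column strict pairs of rows without odd blocks. -/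
theorem sum_Tab_eq (hmu : mu ≤ lam) (hlam : lam.colLen 0 = 2) (a : ℂ) {N : ℕ}
    (h0 : lam.rowLen 0 + 2 ≤ N) (h1 : lam.rowLen 1 + 1 ≤ N) :
    ∑ T ∈ Tab n lam mu, weight T a =
      ∑ p ∈ rowPairs n (mu.rowLen 0 + 2) (lam.rowLen 0 + 2) (mu.rowLen 1 + 1)
          (lam.rowLen 1 + 1) with
        Separated n (mu.rowLen 1 + 1) (lam.rowLen 0 + 2) p ∧ ¬ ∃ k, OddBlockAt n k p,
        pairWeight (letterWeight n a) N p := by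
  have hn := NeZero.pos n
  have hs : mu.rowLen 1 + 1 < mu.rowLen 0 + 2 := by
    have := mu.rowLen_anti 0 1 (by omega)
    omega
  have he : lam.rowLen 1 + 1 < lam.rowLen 0 + 2 := by
    have := lam.rowLen_anti 0 1 (by omega)
    omega
  have m0 := rowLen_le_rowLen hmu 0
  have m1 := rowLen_le_rowLen hmu 1
  have fil : ∀ p ∈ rowPairs n (mu.rowLen 0 + 2) (lam.rowLen 0 + 2) (mu.rowLen 1 + 1)
      (lam.rowLen 1 + 1), filling (toTableau (n := n) lam mu p) 0 2 = baseRow n p.1 ∧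
        filling (toTableau (n := n) lam mu p) 1 1 = baseRow n p.2 := by
    intro p hp
    rw [mem_rowPairs] at hp
    exact ⟨filling_eq_baseRow hp.1 fun j hc => rfl, filling_eq_baseRow hp.2 fun j hc => rfl⟩
  have bl : ∀ T : Tableau n lam mu, baseRow n (toPair T).1 = filling T 0 2 ∧
      baseRow n (toPair T).2 = filling T 1 1 := fun T =>
    ⟨funext ((isFilling_filling m0).base_lift hn), funext ((isFilling_filling m1).base_lift hn)⟩
  have rows : ∀ T : Tableau n lam mu, HRule T → toPair T ∈ rowPairs n (mu.rowLen 0 + 2)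
      (lam.rowLen 0 + 2) (mu.rowLen 1 + 1) (lam.rowLen 1 + 1) := fun T hT =>
    mem_rowPairs.2 ⟨(isFilling_filling m0).isRow_lift hn (hT.hFilling hmu 2 0),
      (isFilling_filling m1).isRow_lift hn (hT.hFilling hmu 1 1)⟩
  symm
  refine Finset.sum_nbij' (toTableau lam mu) toPair ?_ ?_ ?_ ?_ ?_
  · intro p hp
    rw [Finset.mem_filter] at hp
    obtain ⟨hp, hsep, hodd⟩ := hp
    obtain ⟨f0, f1⟩ := fil p hp
    have hp' := mem_rowPairs.1 hp
    rw [Tab, Finset.mem_filter]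
    refine ⟨Finset.mem_univ _, ⟨hRule_of_hFilling ?_, ?_⟩, ?_⟩
    · rintro i ⟨j, x, hx⟩
      have hi := hx.lt_two hlam
      rcases (by omega : i = 0 ∨ i = 1) with rfl | rfl
      · exact ⟨2, f0 ▸ hp'.1.hFilling_base⟩
      · exact ⟨1, f1 ▸ hp'.2.hFilling_base⟩
    · rw [vRule_iff_vFilling hmu hlam, f0, f1]
      exact hsep.vFilling hs he (by omega) hp'.1 hp'.2
    · rw [extraRule_iff_eFilling hmu hlam, f0, f1,
        eFilling_iff_not_oddBlockAt hn hs he (by omega) hp'.1 hp'.2 hsep]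
      exact hodd
  · intro T hT
    rw [Tab, Finset.mem_filter] at hT
    obtain ⟨-, ⟨hH, hV⟩, hE⟩ := hT
    have hp := rows T hH
    have hp' := mem_rowPairs.1 hp
    obtain ⟨b0, b1⟩ := bl T
    rw [vRule_iff_vFilling hmu hlam, ← b0, ← b1] at hV
    rw [extraRule_iff_eFilling hmu hlam, ← b0, ← b1] at hE
    have hsep := hV.separated he (by omega) hp'.1 hp'.2
    rw [Finset.mem_filter]
    exact ⟨hp, hsep,
      (eFilling_iff_not_oddBlockAt hn hs he (by omega) hp'.1 hp'.2 hsep).1 hE⟩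
  · intro p hp
    have hp := (Finset.mem_filter.1 hp).1
    obtain ⟨f0, f1⟩ := fil p hp
    rw [mem_rowPairs] at hp
    rw [toPair, f0, f1, hp.1.lift_base (by omega), hp.2.lift_base (by omega)]
  · intro T hT
    obtain ⟨b0, b1⟩ := bl T
    funext ⟨⟨i, j⟩, hc⟩
    have hi := lt_two_of_mem_skewCells hlam hc
    rcases (by omega : i = 0 ∨ i = 1) with rfl | rfl
    · change letterOf n ((toPair T).1 (j + 2)) = _
      rw [← letterOf_base]
      change letterOf n (baseRow n (toPair T).1 (j + 2)) = _
      rw [b0, filling_of_isEntry ⟨hc, rfl⟩, letterOf_code]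
    · change letterOf n ((toPair T).2 (j + 1)) = _
      rw [← letterOf_base]
      change letterOf n (baseRow n (toPair T).2 (j + 1)) = _
      rw [b1, filling_of_isEntry ⟨hc, rfl⟩, letterOf_code]
  · intro p hp
    exact (weight_toTableau hlam a h0 h1 (Finset.mem_filter.1 hp).1).symm

end Final

end TypeC

end

theorem mainTheorem3 (n : ℕ) [NeZero n] (lam mu : YoungDiagram) (hmu : mu ≤ lam)
    (hlam : lam.colLen 0 = 2) (a : ℂ) :
    TypeC.chi n lam mu a = ∑ T ∈ TypeC.Tab n lam mu, TypeC.weight T a := by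
  have hn := NeZero.pos n
  have hs := mu.rowLen_anti 0 1 (by omega)
  have he := lam.rowLen_anti 0 1 (by omega)
  have det_two : ∀ m, m = 2 → ∀ M : ℕ → ℕ → TypeC.ZRing n,
      Matrix.det (Matrix.of fun i j : Fin m => M i j) = M 0 0 * M 1 1 - M 1 0 * M 0 1 := by
    rintro _ rfl M
    simp [Matrix.det_fin_two, mul_comm (M 0 1)]
  rw [TypeC.chi, det_two _ hlam (fun i j => TypeC.h n
      ((lam.rowLen i : ℤ) - (mu.rowLen j : ℤ) - (i : ℤ) + (j : ℤ))
      (a + 2 * ((lam.rowLen i : ℂ) - ((i : ℕ) + 1 : ℂ)))),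
    TypeC.sum_Tab_eq hmu hlam a (N := lam.rowLen 0 + 2) le_rfl (by omega),
    ← TypeC.sum_sub_sum_eq_sum_separated (lam.rowLen 0 + 2) hn
      (TypeC.letterWeight_congr a (by omega) (by omega) (by simp [TypeC.base]))
      (TypeC.letterWeight_congr a (by omega) (by omega) (by simp [TypeC.base])) (by omega)
      (by omega)]
  simp only [TypeC.rowPairs, TypeC.pairWeight, ← Finset.sum_mul_sum, Finset.sum_product]
  congr 2 <;> refine TypeC.h_eq_sum_words (by omega) (by omega) a _ ?_ _ ?_ <;> push_cast <;> ring
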